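/- **Setting.** Let $\mathcal F$ be a signature containing a constant, and let $\mathcal R$ be a finite term rewrite system (TRS) over $\mathcal F$ and a countably infinite set of variables (left-hand sides are not variables, and variables of right-hand sides occur in the left-hand sides). For a term $t=f(t_1,\dots,t_n)$ let $t^\sharp=f^\sharp(t_1,\dots,t_n)$ with a fresh $n$-ary symbol $f^\sharp$; for variables $x^\sharp=x$. Write $\trianglelefteq$ ($\triangleleft$) for the (proper) subterm relation, $|t|$ for the size and $\mathrm{dp}(t)$ for the depth of $t$ (constants and variables have depth $0$). A symbol is *defined* if it is the root of a left-hand side of $\mathcal R$. The set of dependency pairs is $\mathrm{DP}(\mathcal R)=\{l^\sharp\to u^\sharp \mid l\to r\in\mathcal R,\ u\trianglelefteq r,\ u\not\triangleleft\, l,\ \text{the root of }u\text{ is defined}\}$. Put $\to_{\mathcal A/\mathcal B}\,=\,\to_{\mathcal B}^*\cdot\to_{\mathcal A}\cdot\to_{\mathcal B}^*$, $\mathrm{dh}(s,\to)=\sup\{n\mid \exists t\; s\to^n t\}$, and $\mathrm{dc}_{\mathcal R}(n)=\sup\{\mathrm{dh}(t,\to_{\mathcal R})\mid |t|\le n\}$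 (values in $\mathbb N\cup\{\infty\}$). **Proof trees.** A *proof tree* $\mathsf{PT}$ of $\mathcal R$ is a finite ordered tree whose nodes are DP problems $(\mathcal P,\mathcal R)$, whose root is $(\mathrm{DP}(\mathcal R),\mathcal R)$, and in which every leaf is $(\varnothing,\mathcal R)$ or a trivial strongly connected component as in (iii), and every inner node $(\mathcal P,\mathcal R)$ is of one of the following kinds. (i) *Reduction pair:* it has one child $(\mathcal Q,\mathcal R)$ with $\mathcal Q\subsetneq\mathcal P$, and there is a reduction pair $(\succcurlyeq,\succ)$ with $\mathcal Q\cup\mathcal R\subseteq{\succcurlyeq}$ and $\mathcal P\setminus\mathcal Q\subseteq{\succ}$. (Here $\succcurlyeq$ is a preorder closed under contexts and substitutions, $\succ$ is a well-founded order closed under substitutions, and $\succcurlyeq\cdot\succ\cdot\succcurlyeq\,\subseteq\,\succ$.) (ii) *Subterm criterion:* it has one child $(\mathcal Q,\mathcal R)$ with $\mathcal Q\subsetneq\mathcal P$, and there is a simple projection $\pi$, selecting one argument of each dependency pair symbol, with $\pi(l)\trianglerighteq\pi(r)$ for $l\to r\in\mathcal Q$ and $\pi(l)\triangleright\pi(r)$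 for $l\to r\in\mathcal P\setminus\mathcal Q$. (iii) *Dependency graph:* the dependency graph $\mathcal G$ of $(\mathcal P,\mathcal R)$ has nodes $\mathcal P$ and an edge from $s\to t$ to $u\to v$ iff $t\sigma\to_{\mathcal R}^*u\tau$ for some substitutions $\sigma,\tau$. The children are exactly all SCCs of $\mathcal G$ (a single node with no nonempty path to itself is a *trivial* SCC), each occurring once, from left to right in decreasing order of a rank, which is a bijection from the SCCs to $\{1,\dots,k\}$ such that an SCC has larger rank than every other SCC reachable from it. Trivial SCCs are leaves. $\mathcal P$ is not itself a nontrivial SCC of $\mathcal G$. Let $d$ be one plus the depth of $\mathsf{PT}$ (number of edges of a longest branch). A *reduction pair function* is a monotone $g:\mathbb N\to\mathbb N$ such that $g(n)\ge k$ for the number $k$ of SCCs at every dependency graph node, and $g(n)\ge\mathrm{dh}(t^\sharp,\to_{(\mathcal P\setminus\mathcal Q)/(\mathcal R\cup\mathcal Q)})$ for every reduction pair edge from $(\mathcal P,\mathcal R)$ to $(\mathcal Q,\mathcal R)$ and every term $t$ with $|t|\le n$. Fix such a function $g$. **Norm.** For $p\in \mathrm{DP}(\mathcal R)$ the nodes of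 $\mathsf{PT}$ containing $p$ form a path from the root. The *current path* of a term $t$ is the leftmost of these paths over all $p$ such that $t^\sharp$ is not a normal form of $\to_{\{p\}/\mathcal R}$ (a path counts as further left than its proper prefixes); it is empty if there is no such $p$. For $1\le i\le d$ define $\mathrm{norm}_i(t)$ as follows. If the current path has fewer than $i$ nodes, it is $0$ if the root of $t$ is defined, and $\bot$ otherwise. Else let $(\mathcal P,\mathcal R)$ be its $i$-th node. The value is $\mathrm{dh}(t^\sharp,\to_{\mathcal P/\mathcal R})$ at a leaf; $\mathrm{dh}(t^\sharp,\to_{(\mathcal P\setminus\mathcal Q)/(\mathcal Q\cup\mathcal R)})$ at a reduction pair node with child $\mathcal Q$; the term $\pi(t^\sharp)$ at a subterm criterion node with projection $\pi$; and, at a dependency graph node, the maximal rank of (the SCC of) a pair $l\to r\in\mathcal P$ such that $t^\sharp\to^*_{\mathcal R}l\sigma$ for some $\sigma$. **The simulating TRS.** Let $C$ be the maximal depth of a right-hand side of $\mathcal R$ ($0$ if $\mathcal R=\varnothing$), and let $A\neq1$ be a natural number that is at least the arity of every symbol of $\mathcal F$. Let $\mathcal R'_{\mathsf{sim}}$ be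 a finite TRS over a signature containing the constant $0$ and unary symbols $\mathsf s,\mathsf g$ such that $\mathsf g(\mathsf s^n(0))\to^*_{\mathcal R'_{\mathsf{sim}}}\mathsf s^{g(n)}(0)$ for all $n$. Let $\mathsf f$ be $(d+A)$-ary, let $\mathsf{size},\mathsf{times},\mathsf h,\mathsf{choice}$ be unary, and let $\mathsf c,\mathsf z,\bot$ be constants, all of them not symbols of $\mathcal R'_{\mathsf{sim}}$. Write $\overline t$ for $t,\dots,t$ and $\vec x=x_1,\dots,x_A$, and put $N(\vec x)=\mathsf{choice}(\mathsf f(0,\dots,0,\vec x))$, $M_i^0(u_1,\dots,u_i,\vec x)=\mathsf f(u_1,\dots,u_i,\overline{N(\vec x)},\vec x)$ and $M_i^{m+1}(u_1,\dots,u_i,\vec x)=\mathsf f(u_1,\dots,u_i,\overline{N(\overline{M})},\overline{M})$ with $M=M_i^m(u_1,\dots,u_i,\vec x)$. Then $\mathcal R_{\mathsf{sim}}$ consists of $\mathcal R'_{\mathsf{sim}}$ and the following rules, for $1\le i\le d$ and $1\le j\le A$: 1. $\mathsf f(u_1,\dots,u_{i-1},\mathsf s(u_i),u_{i+1},\dots,u_d,\vec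 x)\to M^C_i(u_1,\dots,u_i,\vec x)$ 2. $\mathsf f(u_1,\dots,u_{i-1},\mathsf f(v_1,\dots,v_d,\vec y),u_{i+1},\dots,u_d,\vec x)\to M^C_i(u_1,\dots,u_{i-1},y_j,\vec x)$ 3. $\mathsf f(u_1,\dots,u_{i-1},\mathsf f(v_1,\dots,v_d,\vec y),u_{i+1},\dots,u_d,\vec x)\to M^C_i(u_1,\dots,u_{i-1},0,\vec x)$ 4. $\mathsf f(u_1,\dots,u_{i-1},0,u_{i+1},\dots,u_d,\vec x)\to M^C_i(u_1,\dots,u_{i-1},\bot,\vec x)$ 5. $\mathsf{size}(\mathsf f(u_1,\dots,u_d,\vec x))\to\mathsf{times}(\mathsf{size}(x_j))$ 6. $\mathsf{size}(\mathsf c)\to\mathsf s(0)$ 7. $\mathsf{times}(\mathsf s(x))\to\mathsf s^A(\mathsf{times}(x))$ 8. $\mathsf{times}(0)\to0$ 9. $\mathsf f(u_1,\dots,u_d,\vec x)\to\mathsf c$ 10. $\mathsf f(u_1,\dots,u_d,\vec x)\to x_j$ 11. $\mathsf h(x)\to\mathsf f(\overline{N(\overline x)},\overline x)$ 12. $\mathsf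 z\to\mathsf f(\overline{N(\overline{\mathsf c})},\overline{\mathsf c})$ 13. $\mathsf{choice}(\mathsf f(u_1,\dots,u_d,\vec x))\to x_j$ 14. $\mathsf{choice}(x)\to\mathsf g(\mathsf{size}(x))$ 15. $\mathsf{choice}(x)\to\bot$ For ground $t=f(t_1,\dots,t_n)$ define recursively $\mathrm{tr}(t)=\mathsf f(\mathrm{norm}_1(t)^*,\dots,\mathrm{norm}_d(t)^*,\mathrm{tr}(t_1),\dots,\mathrm{tr}(t_n),\mathsf c,\dots,\mathsf c)$, where $\bot^*=\bot$, $m^*=\mathsf s^m(0)$ for $m\in\mathbb N$, and $u^*=\mathrm{tr}(u)$ for terms $u$. **Lemma.** (a) For all ground terms $s,t$ over $\mathcal F$: if $s\to_{\mathcal R}t$ then $\mathrm{tr}(s)\to^+_{\mathcal R_{\mathsf{sim}}}\mathrm{tr}(t)$. (b) For every ground term $t$ over $\mathcal F$: $\mathsf h^{\mathrm{dp}(t)}(\mathsf z)\to^+_{\mathcal R_{\mathsf{sim}}}\mathrm{tr}(t)$. (c) $\mathrm{dc}_{\mathcal R}(n)\le\mathrm{dc}_{\mathcal R_{\mathsf{sim}}}(n)$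 for all $n\in\mathbb N$. -/

import Mathlib

/-! Terms, rewriting, derivation heights -/

/-- First-order terms over a signature (a type `F` of function symbols with arities `ar`) and the
countably infinite set `ℕ` of variables. -/
inductive Term {F : Type*} (ar : F → ℕ) where
  | var (x : ℕ) : Term ar
  | app (f : F) (ts : Fin (ar f) → Term ar) : Term ar

namespace Term

variable {F : Type*} {ar : F → ℕ}

/-- Number of occurrences of symbols and variables. -/
def size : Term ar → ℕ
  | var _ => 1
  | app _ ts => 1 + ∑ i, (ts i).size

/-- Variables and constants have depth `0`. -/
def depth : Term ar → ℕ
  | var _ => 0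
  | app _ ts => Finset.univ.sup fun i => (ts i).depth + 1

def vars : Term ar → Set ℕ
  | var x => {x}
  | app _ ts => ⋃ i, (ts i).vars

def IsGround (t : Term ar) : Prop := t.vars = ∅

def subst (σ : ℕ → Term ar) : Term ar → Term ar
  | var x => σ x
  | app f ts => app f fun i => (ts i).subst σ

/-- All function symbols of the term lie in `S`. -/
def SymbolsIn (S : Set F) : Term ar → Prop
  | var _ => True
  | app f ts => f ∈ S ∧ ∀ i, (ts i).SymbolsIn S

/-- `Subterm s t`: `s` is a (not necessarily proper) subterm of `t`. -/
inductive Subterm : Term ar → Term ar → Prop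
  | refl (t : Term ar) : Subterm t t
  | arg {s : Term ar} (f : F) (ts : Fin (ar f) → Term ar) (i : Fin (ar f)) :
      Subterm s (ts i) → Subterm s (app f ts)

def ProperSubterm (s t : Term ar) : Prop := Subterm s t ∧ s ≠ t

end Term

/-- Rewrite rules `lhs → rhs`. -/
structure Rule {F : Type*} (ar : F → ℕ) where
  lhs : Term ar
  rhs : Term ar

section Rewriting

variable {F : Type*} {ar : F → ℕ}

/-- The usual conditions on the rules of a term rewrite system. -/
def IsTRS (R : Set (Rule ar)) : Prop :=
  ∀ ρ ∈ R, (∀ x, ρ.lhs ≠ Term.var x) ∧ ρ.rhs.vars ⊆ ρ.lhs.vars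

/-- One rewrite step, at an arbitrary position. -/
inductive Step (R : Set (Rule ar)) : Term ar → Term ar → Prop
  | root (ρ : Rule ar) (hρ : ρ ∈ R) (σ : ℕ → Term ar) :
      Step R (ρ.lhs.subst σ) (ρ.rhs.subst σ)
  | arg (f : F) (ts : Fin (ar f) → Term ar) (i : Fin (ar f)) (t' : Term ar) :
      Step R (ts i) t' → Step R (Term.app f ts) (Term.app f (Function.update ts i t'))

/-- Zero or more steps. -/
def Steps (R : Set (Rule ar)) : Term ar → Term ar → Prop := Relation.ReflTransGen (Step R)

/-- One or more steps. -/
def StepsPlus (R : Set (Rule ar)) : Term ar → Term ar → Prop := Relation.TransGen (Step R)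

/-- The relative rewrite relation of `R` modulo `S`. -/
def RelStep (R S : Set (Rule ar)) (s t : Term ar) : Prop :=
  ∃ s' t', Steps S s s' ∧ Step R s' t' ∧ Steps S t' t

def IsNF (r : Term ar → Term ar → Prop) (s : Term ar) : Prop := ¬ ∃ t, r s t

/-- `n`-fold composition of a relation. -/
def RelIter (r : Term ar → Term ar → Prop) : ℕ → Term ar → Term ar → Prop
  | 0, s, t => s = t
  | n + 1, s, t => ∃ u, r s u ∧ RelIter r n u t

/-- Derivation height: the supremum of all `n` with `s rⁿ t` for some `t`. -/
noncomputable def dheight (r : Term ar → Term ar → Prop) (s : Term ar) : ℕ∞ :=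
  ⨆ (n : ℕ) (_ : ∃ t, RelIter r n s t), (n : ℕ∞)

/-- Derivational complexity. -/
noncomputable def dc (R : Set (Rule ar)) (n : ℕ) : ℕ∞ :=
  ⨆ (t : Term ar) (_ : t.size ≤ n), dheight (Step R) t

/-- The root of `t` is a function symbol that is the root of a left-hand side of `R`. -/
def RootDefined (R : Set (Rule ar)) (t : Term ar) : Prop :=
  ∃ f ts, t = Term.app f ts ∧ ∃ ρ ∈ R, ∃ us, ρ.lhs = Term.app f us

end Rewriting

/-! Dependency pairs -/

/-- The signature extended by a fresh dependency pair symbol for every function symbol. -/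
inductive Marked (F : Type*) where
  | plain (f : F) : Marked F
  | sharp (f : F) : Marked F

def markedAr {F : Type*} (ar : F → ℕ) : Marked F → ℕ
  | .plain f => ar f
  | .sharp f => ar f

section DependencyPairs

variable {F : Type*} {ar : F → ℕ}

/-- A term over `F`, read over the extended signature. -/
def Term.plain : Term ar → Term (markedAr ar)
  | .var x => .var x
  | .app f ts => .app (.plain f) fun i => (ts i).plain

/-- The term with its root symbol replaced by the dependency pair symbol. -/
def Term.sharp : Term ar → Term (markedAr ar)
  | .var x => .var x
  | .app f ts => .app (.sharp f) fun i => (ts i).plain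

/-- Removes all marks. -/
def Term.unmark : Term (markedAr ar) → Term ar
  | .var x => .var x
  | .app (.plain f) ts => .app f fun i => (ts i).unmark
  | .app (.sharp f) ts => .app f fun i => (ts i).unmark

/-- The rules of `R`, read over the extended signature. -/
def plainRules (R : Set (Rule ar)) : Set (Rule (markedAr ar)) :=
  {ρ' | ∃ ρ ∈ R, ρ' = ⟨ρ.lhs.plain, ρ.rhs.plain⟩}

/-- Dependency pairs. -/
def DP (R : Set (Rule ar)) : Set (Rule (markedAr ar)) :=
  {ρ' | ∃ ρ ∈ R, ∃ u : Term ar, u.Subterm ρ.rhs ∧ ¬ u.ProperSubterm ρ.lhs ∧ RootDefined R u ∧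
    ρ' = ⟨ρ.lhs.sharp, u.sharp⟩}

/-- Reduction pairs on the terms over the extended signature. -/
structure IsReductionPair (geq gt : Term (markedAr ar) → Term (markedAr ar) → Prop) : Prop where
  geq_refl : ∀ t, geq t t
  geq_trans : ∀ s t u, geq s t → geq t u → geq s u
  geq_context : ∀ (f : Marked F) (ts : Fin (markedAr ar f) → Term (markedAr ar))
    (i : Fin (markedAr ar f)) (t' : Term (markedAr ar)), geq (ts i) t' →
      geq (Term.app f ts) (Term.app f (Function.update ts i t'))
  geq_subst : ∀ s t σ, geq s t → geq (s.subst σ) (t.subst σ)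
  gt_trans : ∀ s t u, gt s t → gt t u → gt s u
  gt_wf : WellFounded fun s t => gt t s
  gt_subst : ∀ s t σ, gt s t → gt (s.subst σ) (t.subst σ)
  compat : ∀ s s' t' t, geq s s' → gt s' t' → geq t' t → gt s t

/-- Simple projections: `π f` is the (zero-based) argument position selected for the dependency
pair symbol of `f`. The value is `none` if that is not an argument position of `f`, or if the root
is not a dependency pair symbol. -/
def simpleProj (π : F → ℕ) : Term (markedAr ar) → Option (Term (markedAr ar))
  | .app (.sharp f) ts => if h : π f < ar f then some (ts ⟨π f, h⟩) else none
  | _ => none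

/-- Edges of the dependency graph of `(P, R)`. -/
def DGEdge (R : Set (Rule ar)) (P : Set (Rule (markedAr ar))) (p q : Rule (markedAr ar)) : Prop :=
  p ∈ P ∧ q ∈ P ∧ ∃ σ τ, Steps (plainRules R) (p.rhs.subst σ) (q.lhs.subst τ)

/-- There is a (possibly empty) path from `p` to `q` in the dependency graph of `(P, R)`. -/
def DGPath (R : Set (Rule ar)) (P : Set (Rule (markedAr ar))) :
    Rule (markedAr ar) → Rule (markedAr ar) → Prop :=
  Relation.ReflTransGen (DGEdge R P)

/-- Strongly connected components (trivial or not) of the dependency graph of `(P, R)`. -/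
def IsSCC (R : Set (Rule ar)) (P S : Set (Rule (markedAr ar))) : Prop :=
  Maximal (fun T : Set (Rule (markedAr ar)) =>
    T ⊆ P ∧ T.Nonempty ∧ ∀ p ∈ T, ∀ q ∈ T, DGPath R P p q) S

def IsTrivialSCC (R : Set (Rule ar)) (P S : Set (Rule (markedAr ar))) : Prop :=
  IsSCC R P S ∧ ∃ p, S = {p} ∧ ¬ Relation.TransGen (DGEdge R P) p p

def IsNontrivialSCC (R : Set (Rule ar)) (P S : Set (Rule (markedAr ar))) : Prop :=
  IsSCC R P S ∧ ¬ IsTrivialSCC R P S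

end DependencyPairs

/-! Proof trees -/

/-- Ordered trees whose nodes carry the first component `P` of a DP problem `(P, R)`. Inner nodes
also carry the processor instance that labels the edges to their successors: reduction pair
processor, subterm criterion processor, dependency graph processor. -/
inductive ProofTree {F : Type*} (ar : F → ℕ) where
  | leaf (P : Set (Rule (markedAr ar))) : ProofTree ar
  | rp (P : Set (Rule (markedAr ar)))
      (geq gt : Term (markedAr ar) → Term (markedAr ar) → Prop) (T : ProofTree ar) : ProofTree ar
  | sc (P : Set (Rule (markedAr ar))) (π : F → ℕ) (T : ProofTree ar) : ProofTree ar
  | dg (P : Set (Rule (markedAr ar))) (k : ℕ) (Ts : Fin k → ProofTree ar) : ProofTree ar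

namespace ProofTree

variable {F : Type*} {ar : F → ℕ}

/-- The set of dependency pairs at the root of the tree. -/
def pairs : ProofTree ar → Set (Rule (markedAr ar))
  | leaf P => P
  | rp P _ _ _ => P
  | sc P _ _ => P
  | dg P _ _ => P

/-- Number of edges on a longest branch. -/
def depth : ProofTree ar → ℕ
  | leaf _ => 0
  | rp _ _ _ T => T.depth + 1
  | sc _ _ T => T.depth + 1
  | dg _ _ Ts => Finset.univ.sup fun i => (Ts i).depth + 1

/-- All nodes, each given as the subtree below it. -/
def nodes : ProofTree ar → Set (ProofTree ar)
  | leaf P => {leaf P}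
  | rp P geq gt T => {rp P geq gt T} ∪ T.nodes
  | sc P π T => {sc P π T} ∪ T.nodes
  | dg P k Ts => {dg P k Ts} ∪ ⋃ i, (Ts i).nodes

/-- Every processor application in the tree is legitimate and has an effect, every leaf carries the
empty set or is a trivial SCC below a dependency graph processor. At a dependency graph node with
`k` successors, the successors are exactly the `k` SCCs of the dependency graph, in the order of
decreasing rank: the successor with the (zero-based) index `i` has rank `k - i`. The last condition
for such nodes says that this rank is greater than the rank of all other SCCs that are reachable.
Trivial SCCs are leaves. -/
def Valid (R : Set (Rule ar)) : ProofTree ar → Prop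
  | leaf P => P = ∅
  | rp P geq gt T => T.pairs ⊂ P ∧ IsReductionPair geq gt ∧
      (∀ ρ ∈ T.pairs ∪ plainRules R, geq ρ.lhs ρ.rhs) ∧
      (∀ ρ ∈ P \ T.pairs, gt ρ.lhs ρ.rhs) ∧ T.Valid R
  | sc P π T => T.pairs ⊂ P ∧
      (∀ ρ ∈ T.pairs, ∃ a b, simpleProj π ρ.lhs = some a ∧ simpleProj π ρ.rhs = some b ∧
        b.Subterm a) ∧
      (∀ ρ ∈ P \ T.pairs, ∃ a b, simpleProj π ρ.lhs = some a ∧ simpleProj π ρ.rhs = some b ∧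
        b.ProperSubterm a) ∧ T.Valid R
  | dg P _ Ts => ¬ IsNontrivialSCC R P P ∧
      (∀ S, IsSCC R P S ↔ ∃ i, (Ts i).pairs = S) ∧
      (∀ i j, (Ts i).pairs = (Ts j).pairs → i = j) ∧
      (∀ i j, i ≠ j → (∃ p ∈ (Ts i).pairs, ∃ q ∈ (Ts j).pairs, DGPath R P p q) → i < j) ∧
      (∀ i, (IsTrivialSCC R P (Ts i).pairs ∧ Ts i = leaf (Ts i).pairs) ∨
        (IsNontrivialSCC R P (Ts i).pairs ∧ (Ts i).Valid R))

/-- `PT` is a proof tree of `R`. -/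
def IsProofTreeOf (R : Set (Rule ar)) (PT : ProofTree ar) : Prop :=
  PT.pairs = DP R ∧ PT.Valid R

end ProofTree

section Norm

variable {F : Type*} {ar : F → ℕ}

/-- `g` is a reduction pair function of `R` with respect to `PT`. -/
def IsReductionPairFunction (R : Set (Rule ar)) (PT : ProofTree ar) (g : ℕ → ℕ) : Prop :=
  Monotone g ∧
  (∀ P k Ts, ProofTree.dg P k Ts ∈ PT.nodes → ∀ n, k ≤ g n) ∧
  (∀ P geq gt T, ProofTree.rp P geq gt T ∈ PT.nodes → ∀ (n : ℕ) (t : Term ar), t.size ≤ n →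
    dheight (RelStep (P \ T.pairs) (plainRules R ∪ T.pairs)) t.sharp ≤ (g n : ℕ∞))

/-- Some dependency pair `p` of the node satisfies that the marked term is not a normal form
of `{p}/R`. -/
def Active (R : Set (Rule ar)) (t : Term ar) (T : ProofTree ar) : Prop :=
  ∃ p ∈ T.pairs, ¬ IsNF (RelStep {p} (plainRules R)) t.sharp

open Classical in
/-- The current path of `t` (its nodes from the root on, each given as the subtree below it): the
leftmost of the paths that consist of the nodes containing `p`, for the dependency pairs `p` such
that the marked term is not a normal form of `{p}/R`. So a path is continued whenever some
successor contains such a pair `p`, and it goes to the leftmost successor that does. -/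
noncomputable def currentPath (R : Set (Rule ar)) (t : Term ar) :
    ProofTree ar → List (ProofTree ar)
  | .leaf P => if Active R t (.leaf P) then [.leaf P] else []
  | .rp P geq gt T =>
      if Active R t (.rp P geq gt T) then .rp P geq gt T :: currentPath R t T else []
  | .sc P π T => if Active R t (.sc P π T) then .sc P π T :: currentPath R t T else []
  | .dg P k Ts =>
      if Active R t (.dg P k Ts) then
        .dg P k Ts :: ((List.ofFn fun i => currentPath R t (Ts i)).find?
          fun l => !l.isEmpty).getD []
      else []

/-- The rank of `t` at a dependency graph node with successors `Ts`: the maximal rank of a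
dependency pair whose left-hand side has an instance reachable from the marked term. -/
noncomputable def dgRank (R : Set (Rule ar)) (t : Term ar) (k : ℕ) (Ts : Fin k → ProofTree ar) :
    ℕ :=
  sSup {r : ℕ | ∃ i : Fin k, r = k - (i : ℕ) ∧
    ∃ p ∈ (Ts i).pairs, ∃ σ, Steps (plainRules R) t.sharp (p.lhs.subst σ)}

/-- The disjoint union of `ℕ`, the set of terms and `{⊥}`. -/
inductive NormVal {F : Type*} (ar : F → ℕ) where
  | nat (n : ℕ) : NormVal ar
  | term (u : Term ar) : NormVal ar
  | bot : NormVal ar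

open Classical in
/-- Component `i` (counted from zero) of the norm of `t`. -/
noncomputable def termNorm (R : Set (Rule ar)) (PT : ProofTree ar) (t : Term ar) (i : ℕ) :
    NormVal ar :=
  match (currentPath R t PT)[i]? with
  | none => if RootDefined R t then .nat 0 else .bot
  | some (.leaf P) => .nat (dheight (RelStep P (plainRules R)) t.sharp).toNat
  | some (.rp P _ _ T) =>
      .nat (dheight (RelStep (P \ T.pairs) (plainRules R ∪ T.pairs)) t.sharp).toNat
  | some (.dg _ k Ts) => .nat (dgRank R t k Ts)
  | some (.sc _ π _) =>
      match simpleProj π t.sharp with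
      | some u => .term u.unmark
      | none => .bot

end Norm

/-! The simulating system -/

/-- Symbols of the simulating system; the symbols `aux γ`, together with `succ` and `zero`, are
those of the auxiliary system that computes `g`. -/
inductive SimSym (Γ : Type*) where
  | f | size | times | c | h | z | choice | bot | succ | zero
  | aux (γ : Γ)

def simAr {Γ : Type*} (d A : ℕ) (arΓ : Γ → ℕ) : SimSym Γ → ℕ
  | .f => d + A
  | .size => 1
  | .times => 1
  | .c => 0
  | .h => 1
  | .z => 0
  | .choice => 1
  | .bot => 0
  | .succ => 1
  | .zero => 0
  | .aux γ => arΓ γ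

namespace Sim

section

variable {Γ : Type*} {d A : ℕ} {arΓ : Γ → ℕ}

def fT (us : Fin d → Term (simAr d A arΓ)) (xs : Fin A → Term (simAr d A arΓ)) :
    Term (simAr d A arΓ) :=
  .app .f (Fin.append us xs)

def sizeT (t : Term (simAr d A arΓ)) : Term (simAr d A arΓ) := .app .size fun _ => t
def timesT (t : Term (simAr d A arΓ)) : Term (simAr d A arΓ) := .app .times fun _ => t
def hT (t : Term (simAr d A arΓ)) : Term (simAr d A arΓ) := .app .h fun _ => t
def choiceT (t : Term (simAr d A arΓ)) : Term (simAr d A arΓ) := .app .choice fun _ => t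
def succT (t : Term (simAr d A arΓ)) : Term (simAr d A arΓ) := .app .succ fun _ => t
def cT : Term (simAr d A arΓ) := .app .c Fin.elim0
def zT : Term (simAr d A arΓ) := .app .z Fin.elim0
def botT : Term (simAr d A arΓ) := .app .bot Fin.elim0
def zeroT : Term (simAr d A arΓ) := .app .zero Fin.elim0

/-- `γ(t)`, for a unary symbol `γ` of the auxiliary system. -/
def auxT (γ : Γ) (t : Term (simAr d A arΓ)) : Term (simAr d A arΓ) := .app (.aux γ) fun _ => t

/-- The numeral `sⁿ(0)`. -/
def num (n : ℕ) : Term (simAr d A arΓ) := succT^[n] zeroT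

/-- `N(x₁, …, x_A)`. -/
def nT (xs : Fin A → Term (simAr d A arΓ)) : Term (simAr d A arΓ) := choiceT (fT (fun _ => zeroT) xs)

/-- `M^k_i(u₁, …, u_i, x₁, …, x_A)`; the entries of `us` after index `i` are not used. -/
def mT (i : Fin d) (us : Fin d → Term (simAr d A arΓ)) (xs : Fin A → Term (simAr d A arΓ)) :
    ℕ → Term (simAr d A arΓ)
  | 0 => fT (fun m => if m ≤ i then us m else nT xs) xs
  | k + 1 => fT (fun m => if m ≤ i then us m else nT fun _ => mT i us xs k) fun _ => mT i us xs k

/-- Four disjoint families of variables. -/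
def uV (m : Fin d) : Term (simAr d A arΓ) := .var m
def vV (m : Fin d) : Term (simAr d A arΓ) := .var (d + m)
def xV (j : Fin A) : Term (simAr d A arΓ) := .var (2 * d + j)
def yV (j : Fin A) : Term (simAr d A arΓ) := .var (2 * d + A + j)

end

/-- The rules of the simulating system, apart from those of the auxiliary system; `gs` is the
symbol for `g`. -/
inductive SimRule {Γ : Type*} (d A C : ℕ) (arΓ : Γ → ℕ) (gs : Γ) : Rule (simAr d A arΓ) → Prop
  | r1 (i : Fin d) : SimRule d A C arΓ gs
      ⟨fT (Function.update uV i (succT (uV i))) xV, mT i uV xV C⟩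
  | r2 (i : Fin d) (j : Fin A) : SimRule d A C arΓ gs
      ⟨fT (Function.update uV i (fT vV yV)) xV, mT i (Function.update uV i (yV j)) xV C⟩
  | r3 (i : Fin d) : SimRule d A C arΓ gs
      ⟨fT (Function.update uV i (fT vV yV)) xV, mT i (Function.update uV i zeroT) xV C⟩
  | r4 (i : Fin d) : SimRule d A C arΓ gs
      ⟨fT (Function.update uV i zeroT) xV, mT i (Function.update uV i botT) xV C⟩
  | r5 (j : Fin A) : SimRule d A C arΓ gs ⟨sizeT (fT uV xV), timesT (sizeT (xV j))⟩
  | r6 : SimRule d A C arΓ gs ⟨sizeT cT, succT zeroT⟩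
  | r7 : SimRule d A C arΓ gs ⟨timesT (succT (.var 0)), succT^[A] (timesT (.var 0))⟩
  | r8 : SimRule d A C arΓ gs ⟨timesT zeroT, zeroT⟩
  | r9 : SimRule d A C arΓ gs ⟨fT uV xV, cT⟩
  | r10 (j : Fin A) : SimRule d A C arΓ gs ⟨fT uV xV, xV j⟩
  | r11 : SimRule d A C arΓ gs ⟨hT (.var 0), fT (fun _ => nT fun _ => .var 0) fun _ => .var 0⟩
  | r12 : SimRule d A C arΓ gs ⟨zT, fT (fun _ => nT fun _ => cT) fun _ => cT⟩
  | r13 (j : Fin A) : SimRule d A C arΓ gs ⟨choiceT (fT uV xV), xV j⟩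
  | r14 : SimRule d A C arΓ gs ⟨choiceT (.var 0), auxT gs (sizeT (.var 0))⟩
  | r15 : SimRule d A C arΓ gs ⟨choiceT (.var 0), botT⟩

/-- `Rg` is a term rewrite system over `succ`, `zero` and the symbols of `Γ`, in which the unary
symbol `gs` computes `g`. -/
structure Computes {Γ : Type*} {d A : ℕ} {arΓ : Γ → ℕ} (gs : Γ)
    (Rg : Finset (Rule (simAr d A arΓ))) (g : ℕ → ℕ) : Prop where
  unary : arΓ gs = 1
  isTRS : IsTRS (Rg : Set (Rule (simAr d A arΓ)))
  symbols : ∀ ρ ∈ Rg, ρ.lhs.SymbolsIn ({.succ, .zero} ∪ Set.range .aux) ∧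
    ρ.rhs.SymbolsIn ({.succ, .zero} ∪ Set.range .aux)
  eval : ∀ n, Steps (Rg : Set (Rule (simAr d A arΓ))) (auxT gs (num n)) (num (g n))

end Sim

section Simulation

variable {F : Type*} {ar : F → ℕ}

/-- The maximal depth of a right-hand side. -/
def rhsDepth (R : Finset (Rule ar)) : ℕ := R.sup fun ρ => ρ.rhs.depth

/-- The simulating system of `R`. -/
def Rsim (R : Finset (Rule ar)) (PT : ProofTree ar) (A : ℕ) {Γ : Type*} {arΓ : Γ → ℕ} (gs : Γ)
    (Rg : Finset (Rule (simAr (PT.depth + 1) A arΓ))) :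
    Set (Rule (simAr (PT.depth + 1) A arΓ)) :=
  {ρ | Sim.SimRule (PT.depth + 1) A (rhsDepth R) arΓ gs ρ} ∪ Rg

theorem Term.unmark_plain (t : Term ar) : t.plain.unmark = t := by
  induction t with
  | var x => rfl
  | app f ts ih =>
    simp only [Term.plain, Term.unmark]
    congr 1
    funext i
    exact ih i

theorem Term.size_arg_lt (f : F) (ts : Fin (ar f) → Term ar) (i : Fin (ar f)) :
    (ts i).size < (Term.app f ts).size := by
  have h := Finset.single_le_sum (f := fun i => (ts i).size) (fun _ _ => Nat.zero_le _)
    (Finset.mem_univ i)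
  simp only [Term.size]
  omega

/-- The values of `termNorm` that are terms are proper subterms, so the recursion in `tr` below is
well-founded. -/
theorem termNorm_size_lt {R : Set (Rule ar)} {PT : ProofTree ar} {t u : Term ar} {i : ℕ}
    (h : termNorm R PT t i = .term u) : u.size < t.size := by
  unfold termNorm at h
  split at h
  · split at h <;> cases h
  · cases h
  · cases h
  · cases h
  · split at h
    · rename_i v hv
      cases h
      cases t with
      | var x => simp [Term.sharp, simpleProj] at hv
      | app f ts =>
        simp only [Term.sharp, simpleProj] at hv
        split at hv
        · cases hv
          rw [Term.unmark_plain]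
          exact Term.size_arg_lt f ts _
        · cases hv
    · cases h

/-- The mapping `tr` (on ground terms; variables get a dummy value). -/
noncomputable def tr (R : Set (Rule ar)) (PT : ProofTree ar) (A : ℕ) {Γ : Type*} (arΓ : Γ → ℕ) :
    Term ar → Term (simAr (PT.depth + 1) A arΓ)
  | .var _ => Sim.cT
  | .app f ts =>
      Sim.fT
        (fun i =>
          match h : termNorm R PT (.app f ts) i with
          | .bot => Sim.botT
          | .nat n => Sim.num n
          | .term u => tr R PT A arΓ u)
        (fun j => if h : (j : ℕ) < ar f then tr R PT A arΓ (ts ⟨j, h⟩) else Sim.cT)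
termination_by t => t.size
decreasing_by
  · exact termNorm_size_lt h
  · exact Term.size_arg_lt f ts _

end Simulation

/-! The translation of a term is `f` applied to the entries of its norm and to its translated
arguments. Rules 1–4 lower such tuples lexicographically: one entry gets smaller, the earlier ones
stay, and the later ones become `N`, which can be evaluated afresh. The simulation therefore reduces
to comparing norms before and after a step, which is done by induction on the proof tree.

Root steps lσ → rσ: a subterm u of r that is a proper subterm of l is found inside the translated
arguments of lσ. Any other u needs a new `f`-node. If its root is defined, then p = l♯ → u♯ is a
dependency pair, and `IsPairStep.lexGt` yields a strict lexicographic decrease on the current path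
of lσ: at each node either the entry drops, or it stays equal and p survives in the child that the
path visits. If the root is not defined, all entries of uσ are ⊥. The nested copies in `mT` are as
deep as any right-hand side, so r can be assembled in them (`steps_mT_tr`), each copy then
performing the decrease that its own u needs (`stepsPlus_root`).

Steps below the root: by `stepEq_or_lexGt` the norm either stays the same up to rewriting of
projected terms, which is simulated by induction, or decreases lexicographically. The rewritten
argument itself supplies the strict step.

Evaluation of `N`: `size` descends into a largest argument and multiplies by A at each level, which
gives at least the size of the term (`exists_steps_size`). Hence g of the result bounds every
numerical entry, and a surplus is removed by rule 1. Entries that are terms are arguments of the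
term, and ⊥ is always available. Filling entries in this way also produces every ground term from
`h` and `z`, and the complexity bound follows by concatenating the two kinds of derivations. -/

namespace Term

/-! ### Terms, subterms, substitutions and marks -/

variable {F : Type*} {ar : F → ℕ}

theorem IsGround.arg {f : F} {ts : Fin (ar f) → Term ar} (h : (app f ts).IsGround)
    (i : Fin (ar f)) : (ts i).IsGround := by
  simp only [IsGround, vars, Set.iUnion_eq_empty] at h
  exact h i

theorem IsGround.exists_app {t : Term ar} (h : t.IsGround) : ∃ f ts, t = app f ts := by
  cases t with
  | var x => simp [IsGround, vars] at h
  | app f ts => exact ⟨f, ts, rfl⟩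

theorem Subterm.trans {s t u : Term ar} (h₁ : Subterm s t) (h₂ : Subterm t u) : Subterm s u := by
  induction h₂ with
  | refl => exact h₁
  | arg f ts i _ ih => exact .arg f ts i ih

theorem Subterm.size_le {s t : Term ar} (h : Subterm s t) : s.size ≤ t.size := by
  induction h with
  | refl => exact le_rfl
  | arg f ts i _ ih => exact ih.trans (size_arg_lt f ts i).le

/-- Sizes drop strictly at every argument, so a subterm of an argument is never the whole term. -/
theorem properSubterm_iff {s t : Term ar} :
    ProperSubterm s t ↔ ∃ f ts i, t = app f ts ∧ Subterm s (ts i) := by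
  constructor
  · rintro ⟨h, hne⟩
    cases h with
    | refl => exact absurd rfl hne
    | arg f ts i h => exact ⟨f, ts, i, rfl, h⟩
  · rintro ⟨f, ts, i, rfl, h⟩
    refine ⟨.arg f ts i h, fun e => ?_⟩
    have h₁ := h.size_le
    have h₂ := size_arg_lt f ts i
    rw [e] at h₁
    omega

theorem Subterm.subst {s t : Term ar} (σ : ℕ → Term ar) (h : Subterm s t) :
    Subterm (s.subst σ) (t.subst σ) := by
  induction h with
  | refl => exact .refl _
  | arg f ts i _ ih => exact .arg f (fun i => (ts i).subst σ) i ih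

theorem ProperSubterm.subst {s t : Term ar} (σ : ℕ → Term ar) (h : ProperSubterm s t) :
    ProperSubterm (s.subst σ) (t.subst σ) := by
  obtain ⟨f, ts, i, rfl, hs⟩ := properSubterm_iff.1 h
  exact properSubterm_iff.2 ⟨f, _, i, rfl, hs.subst σ⟩

theorem subterm_var {x : ℕ} {t : Term ar} (h : x ∈ t.vars) : Subterm (var x) t := by
  induction t with
  | var y => simp only [vars, Set.mem_singleton_iff] at h; subst h; exact .refl _
  | app f ts ih =>
    simp only [vars, Set.mem_iUnion] at h
    obtain ⟨i, hi⟩ := h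
    exact .arg f ts i (ih i hi)

theorem Subterm.vars_subset {s t : Term ar} (h : Subterm s t) : s.vars ⊆ t.vars := by
  induction h with
  | refl => exact subset_rfl
  | arg f ts i _ ih =>
    intro x hx
    simp only [vars, Set.mem_iUnion]
    exact ⟨i, ih hx⟩

theorem subst_subst (σ τ : ℕ → Term ar) (t : Term ar) :
    (t.subst σ).subst τ = t.subst fun x => (σ x).subst τ := by
  induction t with
  | var x => rfl
  | app f ts ih => simp only [subst, ih]

theorem vars_subst (σ : ℕ → Term ar) (t : Term ar) :
    (t.subst σ).vars = ⋃ x ∈ t.vars, (σ x).vars := by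
  induction t with
  | var x => simp [subst, vars]
  | app f ts ih =>
    ext y
    simp only [subst, vars, ih, Set.mem_iUnion]
    exact ⟨fun ⟨i, x, hx, hy⟩ => ⟨x, ⟨i, hx⟩, hy⟩, fun ⟨x, ⟨i, hx⟩, hy⟩ => ⟨i, x, hx, hy⟩⟩

theorem IsGround.of_vars_subset {s t : Term ar} {σ : ℕ → Term ar} (h : (t.subst σ).IsGround)
    (hs : s.vars ⊆ t.vars) : (s.subst σ).IsGround := by
  rw [IsGround, vars_subst] at *
  exact Set.subset_eq_empty (Set.biUnion_subset_biUnion_left hs) h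

theorem symbolsIn_subst_iff {S : Set F} (σ : ℕ → Term ar) (t : Term ar) :
    (t.subst σ).SymbolsIn S ↔ t.SymbolsIn S ∧ ∀ x ∈ t.vars, (σ x).SymbolsIn S := by
  induction t with
  | var x => simp [subst, SymbolsIn, vars]
  | app f ts ih =>
    simp only [subst, SymbolsIn, vars, ih, Set.mem_iUnion]
    constructor
    · rintro ⟨h, h'⟩
      exact ⟨⟨h, fun i => (h' i).1⟩, fun x ⟨i, hi⟩ => (h' i).2 x hi⟩
    · rintro ⟨⟨h, h'⟩, h''⟩
      exact ⟨h, fun i => ⟨h' i, fun x hx => h'' x ⟨i, hx⟩⟩⟩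

theorem plain_subst (σ : ℕ → Term ar) (t : Term ar) :
    (t.subst σ).plain = t.plain.subst fun x => (σ x).plain := by
  induction t with
  | var x => rfl
  | app f ts ih => exact congrArg (app (Marked.plain f)) (funext ih)

theorem sharp_app_subst (σ : ℕ → Term ar) (f : F) (ts : Fin (ar f) → Term ar) :
    ((app f ts).subst σ).sharp = (app f ts).sharp.subst fun x => (σ x).plain := by
  exact congrArg (app (Marked.sharp f)) (funext fun i => plain_subst σ (ts i))

theorem plain_symbolsIn (t : Term ar) : t.plain.SymbolsIn (Set.range Marked.plain) := by
  induction t with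
  | var x => trivial
  | app f ts ih => exact ⟨⟨f, rfl⟩, ih⟩

theorem vars_plain (t : Term ar) : t.plain.vars = t.vars := by
  induction t with
  | var x => rfl
  | app f ts ih => exact Set.iUnion_congr ih

theorem Subterm.unmark {s t : Term (markedAr ar)} (h : Subterm s t) :
    Subterm s.unmark t.unmark := by
  induction h with
  | refl => exact .refl _
  | arg f ts i _ ih =>
    cases f with
    | plain f => exact .arg f (fun i => (ts i).unmark) i ih
    | sharp f => exact .arg f (fun i => (ts i).unmark) i ih

theorem ProperSubterm.unmark {s t : Term (markedAr ar)} (h : ProperSubterm s t) :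
    ProperSubterm s.unmark t.unmark := by
  obtain ⟨f, ts, i, rfl, hs⟩ := properSubterm_iff.1 h
  cases f with
  | plain f => exact properSubterm_iff.2 ⟨f, _, i, rfl, hs.unmark⟩
  | sharp f => exact properSubterm_iff.2 ⟨f, _, i, rfl, hs.unmark⟩

end Term

/-! ### Rewriting of marked terms, and reachability of dependency pairs -/

section Rewriting

variable {F : Type*} {ar : F → ℕ} {R S : Set (Rule ar)}

theorem Step.mono (h : R ⊆ S) {s t : Term ar} (hst : Step R s t) : Step S s t := by
  induction hst with
  | root ρ hρ σ => exact .root ρ (h hρ) σ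
  | arg f ts i t' _ ih => exact .arg f ts i t' ih

theorem Steps.mono (h : R ⊆ S) {s t : Term ar} (hst : Steps R s t) : Steps S s t :=
  Relation.ReflTransGen.mono (fun _ _ => Step.mono h) _ _ hst

theorem Step.subst (τ : ℕ → Term ar) {s t : Term ar} (hst : Step R s t) :
    Step R (s.subst τ) (t.subst τ) := by
  induction hst with
  | root ρ hρ σ =>
    rw [Term.subst_subst, Term.subst_subst]
    exact .root ρ hρ _
  | arg f ts i t' _ ih =>
    have h : (fun k => (Function.update ts i t' k).subst τ) =
        Function.update (fun k => (ts k).subst τ) i (t'.subst τ) :=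
      funext fun k => Function.apply_update (fun _ t => Term.subst τ t) ts i t' k
    simp only [Term.subst]
    rw [h]
    exact .arg f (fun k => (ts k).subst τ) i _ ih

theorem step_plainRules {s t : Term ar} (hst : Step R s t) :
    Step (plainRules R) s.plain t.plain := by
  induction hst with
  | root ρ hρ σ =>
    rw [Term.plain_subst, Term.plain_subst]
    exact Step.root (R := plainRules R) ⟨ρ.lhs.plain, ρ.rhs.plain⟩ ⟨ρ, hρ, rfl⟩ _
  | arg f ts i t' _ ih =>
    have h : (fun k => (Function.update ts i t' k).plain) =
        Function.update (fun k => (ts k).plain) i t'.plain :=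
      funext fun k => Function.apply_update (fun _ t => Term.plain t) ts i t' k
    have h' := Step.arg (R := plainRules R) (Marked.plain f) (fun k => (ts k).plain) i _ ih
    exact (congrArg (fun vs => Step (plainRules R) (Term.app f ts).plain
      (Term.app (ar := markedAr ar) (.plain f) vs)) h).mpr h'

theorem step_sharp_arg (f : F) (ts : Fin (ar f) → Term ar) (i : Fin (ar f)) {t' : Term ar}
    (h : Step R (ts i) t') : Step (plainRules R) (Term.app f ts).sharp
      (Term.app f (Function.update ts i t')).sharp := by
  have e : (fun k => (Function.update ts i t' k).plain) =
      Function.update (fun k => (ts k).plain) i t'.plain :=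
    funext fun k => Function.apply_update (fun _ t => Term.plain t) ts i t' k
  have h' := Step.arg (R := plainRules R) (Marked.sharp f) (fun k => (ts k).plain) i _ (step_plainRules h)
  exact (congrArg (fun vs => Step (plainRules R) (Term.app f ts).sharp
    (Term.app (ar := markedAr ar) (.sharp f) vs)) e).mpr h'

/-- The root is the dependency pair symbol of `f`, and there are no other such symbols. -/
def IsSharpWith (f : F) (v : Term (markedAr ar)) : Prop :=
  ∃ vs, v = .app (.sharp f) vs ∧ ∀ i, (vs i).SymbolsIn (Set.range Marked.plain)

theorem isSharpWith_sharp (f : F) (ts : Fin (ar f) → Term ar) :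
    IsSharpWith f (Term.app f ts).sharp :=
  ⟨_, rfl, fun i => (ts i).plain_symbolsIn⟩

/-- Variables of right-hand sides occur in left-hand sides, so a step cannot bring in a mark. -/
theorem Step.symbolsIn_plain (hR : IsTRS R) {v v' : Term (markedAr ar)}
    (h : Step (plainRules R) v v') (hv : v.SymbolsIn (Set.range Marked.plain)) :
    v'.SymbolsIn (Set.range Marked.plain) := by
  induction h with
  | root ρ hρ σ =>
    obtain ⟨ρ, hρ, rfl⟩ := hρ
    rw [Term.symbolsIn_subst_iff] at hv ⊢
    refine ⟨Term.plain_symbolsIn _, fun x hx => hv.2 x ?_⟩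
    simp only [Term.vars_plain] at hx ⊢
    exact (hR ρ hρ).2 hx
  | arg f ts i t' _ ih =>
    refine ⟨hv.1, fun k => ?_⟩
    by_cases hk : k = i
    · subst hk; rw [Function.update_self]; exact ih (hv.2 k)
    · rw [Function.update_of_ne hk]; exact hv.2 k

theorem IsTRS.exists_lhs_eq_app (hR : IsTRS R) {ρ : Rule ar} (hρ : ρ ∈ R) :
    ∃ f ts, ρ.lhs = .app f ts := by
  cases h : ρ.lhs with
  | var x => exact absurd h ((hR ρ hρ).1 x)
  | app f ts => exact ⟨f, ts, rfl⟩

/-- Left-hand sides of plain rules have an unmarked root, so all steps take place strictly below the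
mark. -/
theorem Step.isSharpWith (hR : IsTRS R) {f : F} {v v' : Term (markedAr ar)}
    (h : Step (plainRules R) v v') (hv : IsSharpWith f v) : IsSharpWith f v' := by
  obtain ⟨vs, hv, hvs⟩ := hv
  cases h with
  | root ρ hρ σ =>
    obtain ⟨ρ, hρ, rfl⟩ := hρ
    obtain ⟨f', ts, e⟩ := hR.exists_lhs_eq_app hρ
    simp only [e, Term.plain, Term.subst] at hv
    cases hv
  | arg f' ts i t' h =>
    cases hv
    refine ⟨_, rfl, fun k => ?_⟩
    by_cases hk : k = i
    · subst hk; rw [Function.update_self]; exact h.symbolsIn_plain hR (hvs k)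
    · rw [Function.update_of_ne hk]; exact hvs k

theorem Steps.isSharpWith (hR : IsTRS R) {f : F} {v v' : Term (markedAr ar)}
    (h : Steps (plainRules R) v v') (hv : IsSharpWith f v) : IsSharpWith f v' := by
  induction h with
  | refl => exact hv
  | tail _ h ih => exact h.isSharpWith hR ih

theorem not_step_of_symbolsIn_plain (hR : IsTRS R) {p : Rule (markedAr ar)} (hp : p ∈ DP R)
    {v v' : Term (markedAr ar)} (hv : v.SymbolsIn (Set.range Marked.plain)) :
    ¬ Step {p} v v' := by
  intro h
  induction h with
  | root ρ hρ σ =>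
    obtain rfl := hρ
    obtain ⟨ρ, hρ, u, -, -, -, rfl⟩ := hp
    obtain ⟨f, ts, e⟩ := hR.exists_lhs_eq_app hρ
    simp only [e, Term.sharp, Term.subst, Term.SymbolsIn] at hv
    obtain ⟨⟨_, h⟩, -⟩ := hv
    cases h
  | arg f ts i t' _ ih => exact ih (hv.2 i)

/-- Left-hand sides of pairs start with a mark, and the only mark is at the root; so pair steps are
root steps. -/
theorem exists_of_step_pair (hR : IsTRS R) {p : Rule (markedAr ar)} (hp : p ∈ DP R) {f : F}
    {v v' : Term (markedAr ar)} (hv : IsSharpWith f v) (h : Step {p} v v') :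
    ∃ σ, v = p.lhs.subst σ ∧ v' = p.rhs.subst σ := by
  obtain ⟨vs, hv, hvs⟩ := hv
  cases h with
  | root ρ hρ σ => obtain rfl := hρ; exact ⟨σ, rfl, rfl⟩
  | arg f' ts i t' h =>
    cases hv
    exact absurd h (not_step_of_symbolsIn_plain hR hp (hvs i))

/-- The variables of the right-hand side occur below the root of the left-hand side, where the
instance carries no marks. -/
theorem isSharpWith_rhs_subst (hR : IsTRS R) {p : Rule (markedAr ar)} (hp : p ∈ DP R) {f : F}
    {σ : ℕ → Term (markedAr ar)} (hv : IsSharpWith f (p.lhs.subst σ)) :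
    ∃ f', IsSharpWith f' (p.rhs.subst σ) := by
  obtain ⟨ρ, hρ, u, hu, -, ⟨f', us, rfl, -⟩, rfl⟩ := hp
  obtain ⟨fl, ls, e⟩ := hR.exists_lhs_eq_app hρ
  obtain ⟨vs, hv, hvs⟩ := hv
  simp only [e, Term.sharp, Term.subst] at hv
  cases hv
  refine ⟨f', fun i => (us i).plain.subst σ, rfl, fun i => ?_⟩
  rw [Term.symbolsIn_subst_iff]
  refine ⟨Term.plain_symbolsIn _, fun x hx => ?_⟩
  rw [Term.vars_plain] at hx
  have hx' : x ∈ ρ.lhs.vars := by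
    refine (hR ρ hρ).2 (hu.vars_subset ?_)
    simp only [Term.vars, Set.mem_iUnion]
    exact ⟨i, hx⟩
  rw [e] at hx'
  simp only [Term.vars, Set.mem_iUnion] at hx'
  obtain ⟨j, hj⟩ := hx'
  exact ((Term.symbolsIn_subst_iff _ _).1 (hvs j)).2 x (by rwa [Term.vars_plain])

/-- Some instance of the left-hand side of `p` is reachable from the marked term. -/
def Reaches (R : Set (Rule ar)) (t : Term ar) (p : Rule (markedAr ar)) : Prop :=
  ∃ σ, Steps (plainRules R) t.sharp (p.lhs.subst σ)

theorem not_step_var (hR : IsTRS R) {x : ℕ} {t : Term ar} : ¬ Step R (.var x) t := by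
  intro h
  generalize e : Term.var x = s at h
  cases h with
  | root ρ hρ σ =>
    obtain ⟨f, ts, e'⟩ := hR.exists_lhs_eq_app hρ
    rw [e'] at e
    cases e
  | arg => cases e

theorem isTRS_plainRules (hR : IsTRS R) : IsTRS (plainRules R) := by
  rintro _ ⟨ρ, hρ, rfl⟩
  refine ⟨fun x h => ?_, ?_⟩
  · obtain ⟨f, ts, e⟩ := hR.exists_lhs_eq_app hρ
    simp only [e, Term.plain] at h
    cases h
  · simp only [Term.vars_plain]
    exact (hR ρ hρ).2

theorem exists_lhs_eq_app_of_mem_DP (hR : IsTRS R) {p : Rule (markedAr ar)} (hp : p ∈ DP R) :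
    ∃ f ts, p.lhs = .app (.sharp f) ts ∧ ∃ ρ ∈ R, ∃ us, ρ.lhs = .app f us := by
  obtain ⟨ρ, hρ, u, -, -, -, rfl⟩ := hp
  obtain ⟨f, ts, e⟩ := hR.exists_lhs_eq_app hρ
  exact ⟨f, fun i => (ts i).plain, by simp [e, Term.sharp], ρ, hρ, ts, e⟩

theorem Reaches.exists_app (hR : IsTRS R) {t : Term ar} {p : Rule (markedAr ar)} (hp : p ∈ DP R)
    (h : Reaches R t p) : ∃ f ts, t = .app f ts ∧ (∃ ls, p.lhs = .app (.sharp f) ls) ∧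
      ∃ ρ ∈ R, ∃ us, ρ.lhs = .app f us := by
  obtain ⟨σ, h⟩ := h
  obtain ⟨f, ls, e, hf⟩ := exists_lhs_eq_app_of_mem_DP hR hp
  rw [e] at h
  cases t with
  | var x =>
    rcases Relation.ReflTransGen.cases_head h with h | ⟨_, h, -⟩
    · cases h
    · exact absurd h (not_step_var (isTRS_plainRules hR))
  | app f' ts =>
    obtain ⟨vs, h, -⟩ := Steps.isSharpWith hR h (isSharpWith_sharp f' ts)
    simp only [Term.subst] at h
    cases h
    exact ⟨f, ts, rfl, ⟨ls, e⟩, hf⟩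

theorem Reaches.rootDefined (hR : IsTRS R) {t : Term ar} {p : Rule (markedAr ar)} (hp : p ∈ DP R)
    (h : Reaches R t p) : RootDefined R t := by
  obtain ⟨f, ts, rfl, -, hf⟩ := h.exists_app hR hp
  exact ⟨f, ts, rfl, hf⟩

/-- Pair steps are root steps, so being reducible by p modulo R means reaching an instance of its
left-hand side. In this form the condition pulls back along steps. -/
theorem not_isNF_iff_reaches (hR : IsTRS R) {t : Term ar} {p : Rule (markedAr ar)}
    (hp : p ∈ DP R) : ¬ IsNF (RelStep {p} (plainRules R)) t.sharp ↔ Reaches R t p := by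
  simp only [IsNF, not_not]
  constructor
  · rintro ⟨v, s', t', h₁, h₂, -⟩
    cases t with
    | var x =>
      rcases Relation.ReflTransGen.cases_head h₁ with h | ⟨_, h, -⟩
      · subst h
        exact absurd h₂ (not_step_of_symbolsIn_plain hR hp trivial)
      · exact absurd h (not_step_var (isTRS_plainRules hR))
    | app f ts =>
      obtain ⟨σ, rfl, -⟩ :=
        exists_of_step_pair hR hp (Steps.isSharpWith hR h₁ (isSharpWith_sharp f ts)) h₂
      exact ⟨σ, h₁⟩
  · rintro ⟨σ, h⟩
    exact ⟨p.rhs.subst σ, _, _, h, .root p (Set.mem_singleton p) σ, .refl⟩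

theorem active_iff (hR : IsTRS R) {t : Term ar} {T : ProofTree ar} (hT : T.pairs ⊆ DP R) :
    Active R t T ↔ ∃ p ∈ T.pairs, Reaches R t p :=
  exists_congr fun _ => and_congr_right fun h => not_isNF_iff_reaches hR (hT h)

theorem Reaches.of_step {s t : Term ar} {p : Rule (markedAr ar)}
    (h : Step (plainRules R) s.sharp t.sharp) (ht : Reaches R t p) : Reaches R s p :=
  ht.imp fun _ => .head h

/-! Derivation heights -/

theorem le_dheight {r : Term ar → Term ar → Prop} {n : ℕ} {s t : Term ar} (h : RelIter r n s t) :
    (n : ℕ∞) ≤ dheight r s :=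
  le_iSup₂ (f := fun (n : ℕ) (_ : ∃ t, RelIter r n s t) => (n : ℕ∞)) n ⟨t, h⟩

theorem dheight_le {r : Term ar → Term ar → Prop} {b : ℕ∞} {s : Term ar}
    (h : ∀ n t, RelIter r n s t → (n : ℕ∞) ≤ b) : dheight r s ≤ b :=
  iSup₂_le fun n ⟨t, ht⟩ => h n t ht

/-- The additional step of `S` is absorbed into the first relative step. -/
theorem dheight_le_of_step {s s' : Term ar} (h : Step S s s') :
    dheight (RelStep R S) s' ≤ dheight (RelStep R S) s := by
  refine dheight_le fun n t ht => ?_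
  cases n with
  | zero => simp
  | succ n =>
    obtain ⟨u, ⟨a, b, h₁, h₂, h₃⟩, hu⟩ := ht
    exact le_dheight (t := t) ⟨u, ⟨a, b, .head h h₁, h₂, h₃⟩, hu⟩

theorem toNat_dheight_le_of_step {s s' : Term ar} (h : Step S s s')
    (hs : dheight (RelStep R S) s ≠ ⊤) :
    (dheight (RelStep R S) s').toNat ≤ (dheight (RelStep R S) s).toNat :=
  ENat.toNat_le_toNat (dheight_le_of_step h) hs

/-- Finiteness is essential, because `toNat` sends `⊤` to `0`. -/
theorem toNat_dheight_lt {r : Term ar → Term ar → Prop} {s s' : Term ar} (h : r s s')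
    (hs : dheight r s ≠ ⊤) : (dheight r s').toNat < (dheight r s).toNat := by
  obtain ⟨N, hN⟩ := ENat.ne_top_iff_exists.1 hs
  have key : ∀ n t, RelIter r n s' t → n + 1 ≤ N := by
    intro n t ht
    have := le_dheight (r := r) (n := n + 1) (s := s) (t := t) ⟨s', h, ht⟩
    rw [← hN] at this
    exact_mod_cast this
  have h1 : 1 ≤ N := key 0 s' rfl
  have h2 : dheight r s' ≤ ((N - 1 : ℕ) : ℕ∞) :=
    dheight_le fun n t ht => by have := key n t ht; exact_mod_cast (by omega : n ≤ N - 1)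
  have h3 := ENat.toNat_le_toNat h2 (ENat.natCast_ne_top _)
  rw [ENat.toNat_natCast] at h3
  rw [← hN, ENat.toNat_natCast]
  omega

end Rewriting

/-! ### Proof trees, current paths and the entries of norms -/

section Norms

variable {F : Type*} {ar : F → ℕ} {R : Set (Rule ar)} {g : ℕ → ℕ}

/-- The dependency pair `q` can follow `p` in a chain. -/
def Follows (R : Set (Rule ar)) (p q : Rule (markedAr ar)) : Prop :=
  ∃ σ τ, Steps (plainRules R) (p.rhs.subst σ) (q.lhs.subst τ)

/-- The properties of proof trees and reduction pair functions on which the comparison of norms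
depends. -/
def ProofTree.Good (R : Set (Rule ar)) (g : ℕ → ℕ) : ProofTree ar → Prop
  | leaf P => P ⊆ DP R ∧ (∀ p ∈ P, ∀ q ∈ P, ¬ Follows R p q) ∧ (P.Nonempty → ∀ n, 1 ≤ g n)
  | rp P _ _ T => P ⊆ DP R ∧ T.pairs ⊆ P ∧
      (∀ (n : ℕ) (t : Term ar), t.size ≤ n →
        dheight (RelStep (P \ T.pairs) (plainRules R ∪ T.pairs)) t.sharp ≤ (g n : ℕ∞)) ∧ T.Good R g
  | sc P π T => P ⊆ DP R ∧ T.pairs ⊆ P ∧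
      (∀ ρ ∈ P, ∃ a b, simpleProj π ρ.lhs = some a ∧ simpleProj π ρ.rhs = some b ∧
        b.Subterm a ∧ (ρ ∉ T.pairs → b.ProperSubterm a)) ∧ T.Good R g
  | dg P k Ts => P ⊆ DP R ∧ (∀ n, k ≤ g n) ∧ (∀ p, p ∈ P ↔ ∃ i, p ∈ (Ts i).pairs) ∧
      (∀ i j, ∀ p ∈ (Ts i).pairs, ∀ q ∈ (Ts j).pairs, Follows R p q → i ≤ j) ∧
      ∀ i, (Ts i).Good R g

namespace ProofTree

theorem Good.pairs_subset {T : ProofTree ar} (h : T.Good R g) : T.pairs ⊆ DP R := by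
  cases T <;> exact h.1

/-- The component is the class of pairs that are mutually reachable with `p`. -/
theorem exists_isSCC {P : Set (Rule (markedAr ar))} {p : Rule (markedAr ar)} (hp : p ∈ P) :
    ∃ S, IsSCC R P S ∧ p ∈ S := by
  refine ⟨{q | q ∈ P ∧ DGPath R P p q ∧ DGPath R P q p}, ⟨⟨fun q hq => hq.1,
    ⟨p, hp, .refl, .refl⟩, fun q hq q' hq' => hq.2.2.trans hq'.2.1⟩, ?_⟩, hp, .refl, .refl⟩
  rintro S' ⟨h₁, -, h₂⟩ hle q hq
  have hp' := hle (⟨hp, .refl, .refl⟩ : p ∈ {q | q ∈ P ∧ DGPath R P p q ∧ DGPath R P q p})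
  exact ⟨h₁ hq, h₂ p hp' q hq, h₂ q hq p hp'⟩

theorem Valid.good {T : ProofTree ar} (hT : T.Valid R) (hDP : T.pairs ⊆ DP R)
    (hdg : ∀ P k Ts, dg P k Ts ∈ T.nodes → ∀ n, k ≤ g n)
    (hrp : ∀ P geq gt T', rp P geq gt T' ∈ T.nodes → ∀ (n : ℕ) (t : Term ar), t.size ≤ n →
      dheight (RelStep (P \ T'.pairs) (plainRules R ∪ T'.pairs)) t.sharp ≤ (g n : ℕ∞)) :
    T.Good R g := by
  induction T with
  | leaf P =>
    have hP : P = ∅ := hT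
    subst hP
    exact ⟨hDP, fun _ h => h.elim, fun h => absurd h (by simp)⟩
  | rp P geq gt T ih =>
    obtain ⟨h₁, -, -, -, h₂⟩ := hT
    exact ⟨hDP, h₁.1, hrp P geq gt T (Or.inl rfl), ih h₂ (h₁.1.trans hDP)
      (fun P k Ts h => hdg P k Ts (Or.inr h)) (fun P geq gt T' h => hrp P geq gt T' (Or.inr h))⟩
  | sc P π T ih =>
    obtain ⟨h₁, h₂, h₃, h₄⟩ := hT
    refine ⟨hDP, h₁.1, fun ρ hρ => ?_, ih h₄ (h₁.1.trans hDP)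
      (fun P k Ts h => hdg P k Ts (Or.inr h)) (fun P geq gt T' h => hrp P geq gt T' (Or.inr h))⟩
    by_cases hρ' : ρ ∈ T.pairs
    · obtain ⟨a, b, ha, hb, h⟩ := h₂ ρ hρ'
      exact ⟨a, b, ha, hb, h, fun h => absurd hρ' h⟩
    · obtain ⟨a, b, ha, hb, h⟩ := h₃ ρ ⟨hρ, hρ'⟩
      exact ⟨a, b, ha, hb, h.1, fun _ => h⟩
  | dg P k Ts ih =>
    obtain ⟨-, h₁, -, h₃, h₄⟩ := hT
    have hsub : ∀ i, (Ts i).pairs ⊆ P := fun i => ((h₁ _).2 ⟨i, rfl⟩).prop.1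
    have hk : ∀ n, k ≤ g n := hdg P k Ts (Or.inl rfl)
    refine ⟨hDP, hk, fun p => ⟨fun hp => ?_, fun ⟨i, hi⟩ => hsub i hi⟩, ?_, fun i => ?_⟩
    · obtain ⟨S, hS, hpS⟩ := exists_isSCC (R := R) hp
      obtain ⟨i, rfl⟩ := (h₁ S).1 hS
      exact ⟨i, hpS⟩
    -- Since both pairs belong to `P`, this is an edge of the graph, and edges between different
    -- components lead to the right.
    · intro i j p hp q hq hpq
      by_cases hij : i = j
      · exact hij.le
      · exact (h₃ i j hij ⟨p, hp, q, hq, .single ⟨hsub i hp, hsub j hq, hpq⟩⟩).le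
    -- A trivial component has no edge to itself. The existence of the index `i` forces `k ≥ 1`,
    -- which yields the bound `1 ≤ g n` needed at such leaves.
    · rcases h₄ i with ⟨⟨-, p, hp, hpp⟩, hleaf⟩ | ⟨-, hval⟩
      · rw [hleaf]
        refine ⟨(hsub i).trans hDP, fun q hq q' hq' h => hpp ?_, fun _ n =>
          (Nat.one_le_iff_ne_zero.2 ?_).trans (hk n)⟩
        · rw [hp] at hq hq'
          obtain rfl := hq
          obtain rfl := hq'
          have hqP : q' ∈ P := hsub i (by rw [hp]; rfl)
          exact .single ⟨hqP, hqP, h⟩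
        · rintro rfl
          exact i.elim0
      · exact ih i hval ((hsub i).trans hDP)
          (fun P k' Ts' h => hdg P k' Ts' (Or.inr (Set.mem_iUnion.2 ⟨i, h⟩)))
          (fun P geq gt T' h => hrp P geq gt T' (Or.inr (Set.mem_iUnion.2 ⟨i, h⟩)))

end ProofTree

/-! Computing norms -/

theorem currentPath_of_not_active {t : Term ar} {T : ProofTree ar} (h : ¬ Active R t T) :
    currentPath R t T = [] := by
  cases T <;> simp [currentPath, h]

theorem currentPath_ne_nil {t : Term ar} {T : ProofTree ar} (h : Active R t T) :
    currentPath R t T ≠ [] := by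
  cases T <;> simp [currentPath, h]

/-- `i` is the index of the leftmost active subtree. -/
def IsFirstActive (R : Set (Rule ar)) (t : Term ar) {k : ℕ} (Ts : Fin k → ProofTree ar)
    (i : Fin k) : Prop :=
  Active R t (Ts i) ∧ ∀ j, Active R t (Ts j) → i ≤ j

theorem exists_isFirstActive {t : Term ar} {k : ℕ} {Ts : Fin k → ProofTree ar} {i : Fin k}
    (h : Active R t (Ts i)) : ∃ j, IsFirstActive R t Ts j := by
  classical
  have hne : (Finset.univ.filter fun j => Active R t (Ts j)).Nonempty := ⟨i, by simpa using h⟩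
  exact ⟨_, by simpa using Finset.min'_mem _ hne,
    fun j hj => Finset.min'_le _ j (Finset.mem_filter.2 ⟨Finset.mem_univ j, hj⟩)⟩

/-- The paths of the successors are nonempty exactly for active ones, so the search stops at the
leftmost of these. -/
theorem find?_ofFn_isFirstActive {t : Term ar} {k : ℕ} {Ts : Fin k → ProofTree ar} {i : Fin k}
    (h : IsFirstActive R t Ts i) :
    (List.ofFn fun i => currentPath R t (Ts i)).find? (fun l => !l.isEmpty) =
      some (currentPath R t (Ts i)) := by
  rw [List.find?_eq_some_iff_getElem]
  refine ⟨by simpa using currentPath_ne_nil h.1, i, by simp, by simp, fun j hj => ?_⟩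
  have : ¬ Active R t (Ts ⟨j, hj.trans i.2⟩) := fun h' => absurd (h.2 _ h') (not_le.2 hj)
  simp [currentPath_of_not_active this]

open Classical in
/-- The value of the norm beyond the end of the current path. -/
noncomputable def normDefault (R : Set (Rule ar)) (t : Term ar) : NormVal ar :=
  if RootDefined R t then .nat 0 else .bot

theorem normDefault_of_rootDefined {t : Term ar} (h : RootDefined R t) :
    normDefault R t = .nat 0 := if_pos h

theorem normDefault_of_not_rootDefined {t : Term ar} (h : ¬ RootDefined R t) :
    normDefault R t = .bot := if_neg h

theorem termNorm_of_length_le {t : Term ar} {T : ProofTree ar} {i : ℕ}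
    (h : (currentPath R t T).length ≤ i) : termNorm R T t i = normDefault R t := by
  rw [termNorm, List.getElem?_eq_none h]
  rfl

theorem termNorm_of_not_active {t : Term ar} {T : ProofTree ar} (h : ¬ Active R t T) (i : ℕ) :
    termNorm R T t i = normDefault R t :=
  termNorm_of_length_le (by simp [currentPath_of_not_active h])

section

variable {t : Term ar} {P : Set (Rule (markedAr ar))}

theorem termNorm_leaf_zero (h : Active R t (.leaf P)) :
    termNorm R (.leaf P) t 0 = .nat (dheight (RelStep P (plainRules R)) t.sharp).toNat := by
  simp [termNorm, currentPath, h]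

theorem termNorm_leaf_succ (h : Active R t (.leaf P)) (i : ℕ) :
    termNorm R (.leaf P) t (i + 1) = normDefault R t :=
  termNorm_of_length_le (by simp [currentPath, h])

variable {geq gt : Term (markedAr ar) → Term (markedAr ar) → Prop} {T : ProofTree ar}

theorem termNorm_rp_zero (h : Active R t (.rp P geq gt T)) :
    termNorm R (.rp P geq gt T) t 0 = .nat
      (dheight (RelStep (P \ T.pairs) (plainRules R ∪ T.pairs)) t.sharp).toNat := by
  simp [termNorm, currentPath, h]

theorem termNorm_rp_succ (h : Active R t (.rp P geq gt T)) (i : ℕ) :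
    termNorm R (.rp P geq gt T) t (i + 1) = termNorm R T t i := by
  simp [termNorm, currentPath, h]

theorem length_currentPath_rp (h : Active R t (.rp P geq gt T)) :
    (currentPath R t (.rp P geq gt T)).length = (currentPath R t T).length + 1 := by
  simp [currentPath, h]

variable {π : F → ℕ}

theorem termNorm_sc_zero (h : Active R t (.sc P π T)) {u : Term (markedAr ar)}
    (hu : simpleProj π t.sharp = some u) :
    termNorm R (.sc P π T) t 0 = .term u.unmark := by
  simp [termNorm, currentPath, h, hu]

theorem termNorm_sc_succ (h : Active R t (.sc P π T)) (i : ℕ) :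
    termNorm R (.sc P π T) t (i + 1) = termNorm R T t i := by
  simp [termNorm, currentPath, h]

theorem length_currentPath_sc (h : Active R t (.sc P π T)) :
    (currentPath R t (.sc P π T)).length = (currentPath R t T).length + 1 := by
  simp [currentPath, h]

variable {k : ℕ} {Ts : Fin k → ProofTree ar} {i₀ : Fin k}

theorem currentPath_dg (h : Active R t (.dg P k Ts)) (hi : IsFirstActive R t Ts i₀) :
    currentPath R t (.dg P k Ts) = .dg P k Ts :: currentPath R t (Ts i₀) := by
  simp [currentPath, h, find?_ofFn_isFirstActive hi]

theorem termNorm_dg_zero (h : Active R t (.dg P k Ts)) :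
    termNorm R (.dg P k Ts) t 0 = .nat (dgRank R t k Ts) := by
  simp [termNorm, currentPath, h]

theorem termNorm_dg_succ (h : Active R t (.dg P k Ts)) (hi : IsFirstActive R t Ts i₀) (i : ℕ) :
    termNorm R (.dg P k Ts) t (i + 1) = termNorm R (Ts i₀) t i := by
  simp [termNorm, currentPath_dg h hi]

theorem length_currentPath_dg (h : Active R t (.dg P k Ts)) (hi : IsFirstActive R t Ts i₀) :
    (currentPath R t (.dg P k Ts)).length = (currentPath R t (Ts i₀)).length + 1 := by
  simp [currentPath_dg h hi]

/-- Ranks decrease from left to right, so the maximal rank belongs to the very successor through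
which the current path continues. -/
theorem dgRank_eq (hR : IsTRS R) (hP : ∀ i, (Ts i).pairs ⊆ DP R) (hi : IsFirstActive R t Ts i₀) :
    dgRank R t k Ts = k - i₀ := by
  have hmem : ∀ i : Fin k, (∃ p ∈ (Ts i).pairs, ∃ σ, Steps (plainRules R) t.sharp
      (p.lhs.subst σ)) ↔ Active R t (Ts i) := fun i => (active_iff hR (hP i)).symm
  refine IsGreatest.csSup_eq ⟨⟨i₀, rfl, (hmem i₀).2 hi.1⟩, ?_⟩
  rintro r ⟨i, rfl, h⟩
  have := hi.2 i ((hmem i).1 h)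
  have : (i₀ : ℕ) ≤ i := this
  omega

end

theorem Active.exists_isFirstActive (hR : IsTRS R) {t : Term ar} {P : Set (Rule (markedAr ar))}
    {k : ℕ} {Ts : Fin k → ProofTree ar} (hT : (ProofTree.dg P k Ts).Good R g)
    (h : Active R t (.dg P k Ts)) : ∃ i, IsFirstActive R t Ts i := by
  obtain ⟨p, hp, hpt⟩ := (active_iff hR hT.pairs_subset).1 h
  obtain ⟨i, hi⟩ := (hT.2.2.1 p).1 hp
  exact _root_.exists_isFirstActive ((active_iff hR (hT.2.2.2.2 i).pairs_subset).2 ⟨p, hi, hpt⟩)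

/-- At a leaf that is a trivial component, derivations have length at most one. -/
theorem dheight_leaf (hR : IsTRS R) {P : Set (Rule (markedAr ar))}
    (hT : (ProofTree.leaf P).Good R g) {t : Term ar} (h : Active R t (.leaf P)) :
    dheight (RelStep P (plainRules R)) t.sharp = 1 := by
  obtain ⟨hP, hfol, -⟩ := hT
  have hpair : ∀ {s t}, Step P s t → ∃ p ∈ P, Step {p} s t := by
    intro s t h
    induction h with
    | root ρ hρ σ => exact ⟨ρ, hρ, .root ρ (Set.mem_singleton ρ) σ⟩
    | arg f ts i t' _ ih => exact ih.imp fun p hp => ⟨hp.1, .arg f ts i t' hp.2⟩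
  obtain ⟨p, hp, hpt⟩ := (active_iff (T := .leaf P) hR hP).1 h
  obtain ⟨f, ts, rfl, -⟩ := hpt.exists_app hR (hP hp)
  apply le_antisymm
  · refine dheight_le fun n v hv => ?_
    match n, hv with
    | 0, _ => simp
    | 1, _ => simp
    -- Two relative steps would make the second pair follow the first, which is excluded at leaves.
    | n + 2, ⟨v₁, ⟨a, b, h₁, h₂, h₃⟩, v₂, ⟨a', b', h₁', h₂', _⟩, _⟩ =>
      exfalso
      obtain ⟨q, hq, h₂⟩ := hpair h₂
      obtain ⟨q', hq', h₂'⟩ := hpair h₂'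
      have hs := Steps.isSharpWith hR h₁ (isSharpWith_sharp f ts)
      obtain ⟨σ, rfl, rfl⟩ := exists_of_step_pair hR (hP hq) hs h₂
      obtain ⟨f', hs'⟩ := isSharpWith_rhs_subst hR (hP hq) hs
      have h₄ := Relation.ReflTransGen.trans h₃ h₁'
      obtain ⟨τ, rfl, -⟩ := exists_of_step_pair hR (hP hq') (Steps.isSharpWith hR h₄ hs') h₂'
      exact hfol q hq q' hq' ⟨σ, τ, h₄⟩
  · obtain ⟨σ, hσ⟩ := hpt
    have := le_dheight (r := RelStep P (plainRules R)) (n := 1) (s := (Term.app f ts).sharp)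
      (t := p.rhs.subst σ) ⟨_, ⟨_, _, hσ, .root p hp σ, .refl⟩, rfl⟩
    simpa using this

theorem simpleProj_subst {π : F → ℕ} {v a : Term (markedAr ar)} (σ : ℕ → Term (markedAr ar))
    (h : simpleProj π v = some a) : simpleProj π (v.subst σ) = some (a.subst σ) := by
  cases v with
  | var x => simp [simpleProj] at h
  | app f vs =>
    cases f with
    | plain f => simp [simpleProj] at h
    | sharp f =>
      simp only [simpleProj, Term.subst] at h ⊢
      split at h
      · rename_i hπ
        cases h
        rw [dif_pos hπ]
      · cases h

/-- At a subterm criterion node, the projection selects an argument of active terms. -/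
theorem Active.simpleProj_sharp (hR : IsTRS R) {P : Set (Rule (markedAr ar))} {π : F → ℕ}
    {T : ProofTree ar} (hT : (ProofTree.sc P π T).Good R g) {f : F} {ts : Fin (ar f) → Term ar}
    (h : Active R (.app f ts) (.sc P π T)) :
    ∃ hπ : π f < ar f, ∀ us : Fin (ar f) → Term ar,
      simpleProj π (Term.app f us).sharp = some (us ⟨π f, hπ⟩).plain := by
  obtain ⟨p, hp, hpt⟩ := (active_iff hR hT.pairs_subset).1 h
  obtain ⟨_, _, e, ⟨ls, hls⟩, -⟩ := hpt.exists_app hR (hT.pairs_subset hp)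
  cases e
  obtain ⟨a, b, ha, -⟩ := hT.2.2.1 p hp
  rw [hls] at ha
  simp only [simpleProj] at ha
  split at ha
  · rename_i hπ
    exact ⟨hπ, fun us => dif_pos hπ⟩
  · cases ha

end Norms

/-! ### Lexicographic comparison of norms -/

section Compare

variable {F : Type*} {ar : F → ℕ} {R : Set (Rule ar)} {g : ℕ → ℕ}

/-- The order on the values of norms. -/
inductive NormVal.Gt : NormVal ar → NormVal ar → Prop
  | nat_nat {m n : ℕ} : n < m → Gt (.nat m) (.nat n)
  | nat_bot (m : ℕ) : Gt (.nat m) .bot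
  | term_term {u v : Term ar} : v.ProperSubterm u → Gt (.term u) (.term v)
  | term_zero (u : Term ar) : Gt (.term u) (.nat 0)
  | term_bot (u : Term ar) : Gt (.term u) .bot

/-- Equality up to a rewrite step in a term. -/
inductive NormVal.StepEq (R : Set (Rule ar)) : NormVal ar → NormVal ar → Prop
  | refl (a : NormVal ar) : StepEq R a a
  | step {u v : Term ar} : Step R u v → StepEq R (.term u) (.term v)

/-- Lexicographic comparison with a strict decrease before index `L`. -/
def LexGt (E : NormVal ar → NormVal ar → Prop) (L : ℕ) (a b : ℕ → NormVal ar) : Prop :=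
  ∃ j < L, (∀ k < j, E (a k) (b k)) ∧ (a j).Gt (b j)

theorem LexGt.of_zero {E : NormVal ar → NormVal ar → Prop} {L : ℕ} {a b : ℕ → NormVal ar}
    (h : (a 0).Gt (b 0)) : LexGt E (L + 1) a b :=
  ⟨0, L.succ_pos, fun _ h => absurd h (Nat.not_lt_zero _), h⟩

theorem LexGt.of_succ {E : NormVal ar → NormVal ar → Prop} {L : ℕ} {a b : ℕ → NormVal ar}
    (h₀ : E (a 0) (b 0)) (h : LexGt E L (fun k => a (k + 1)) (fun k => b (k + 1))) :
    LexGt E (L + 1) a b := by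
  obtain ⟨j, hj, hE, hgt⟩ := h
  refine ⟨j + 1, Nat.succ_lt_succ hj, fun k hk => ?_, hgt⟩
  cases k with
  | zero => exact h₀
  | succ k => exact hE k (Nat.lt_of_succ_lt_succ hk)

/-- Values of the norm on the current path. -/
theorem termNorm_cases (hR : IsTRS R) {f : F} {ts : Fin (ar f) → Term ar} {T : ProofTree ar}
    (hT : T.Good R g) {i : ℕ} (hi : i < (currentPath R (.app f ts) T).length) :
    (∃ n ≤ g (Term.app f ts).size, termNorm R T (.app f ts) i = .nat n) ∨
      ∃ j, termNorm R T (.app f ts) i = .term (ts j) := by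
  induction T generalizing i with
  | leaf P =>
    by_cases h : Active R (.app f ts) (.leaf P)
    · have : i = 0 := by simpa [currentPath, h] using hi
      subst this
      obtain ⟨p, hp, -⟩ := (active_iff hR hT.pairs_subset).1 h
      refine .inl ⟨1, hT.2.2 ⟨p, hp⟩ _, ?_⟩
      rw [termNorm_leaf_zero h, dheight_leaf hR hT h]
      rfl
    · simp [currentPath_of_not_active h] at hi
  | rp P geq gt T ih =>
    by_cases h : Active R (.app f ts) (.rp P geq gt T)
    · cases i with
      | zero =>
        refine .inl ⟨_, ?_, termNorm_rp_zero h⟩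
        have := ENat.toNat_le_toNat (hT.2.2.1 _ (.app f ts) le_rfl) (ENat.natCast_ne_top _)
        rwa [ENat.toNat_natCast] at this
      | succ i =>
        rw [length_currentPath_rp h] at hi
        rw [termNorm_rp_succ h]
        exact ih hT.2.2.2 (Nat.lt_of_succ_lt_succ hi)
    · simp [currentPath_of_not_active h] at hi
  | sc P π T ih =>
    by_cases h : Active R (.app f ts) (.sc P π T)
    · cases i with
      | zero =>
        obtain ⟨hπ, h'⟩ := h.simpleProj_sharp hR hT
        right
        exact ⟨⟨π f, hπ⟩, by rw [termNorm_sc_zero h (h' ts), Term.unmark_plain]⟩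
      | succ i =>
        rw [length_currentPath_sc h] at hi
        rw [termNorm_sc_succ h]
        exact ih hT.2.2.2 (Nat.lt_of_succ_lt_succ hi)
    · simp [currentPath_of_not_active h] at hi
  | dg P k Ts ih =>
    by_cases h : Active R (.app f ts) (.dg P k Ts)
    · obtain ⟨i₀, hi₀⟩ := h.exists_isFirstActive hR hT
      cases i with
      | zero =>
        refine .inl ⟨_, ?_, termNorm_dg_zero h⟩
        rw [dgRank_eq hR (fun i => (hT.2.2.2.2 i).pairs_subset) hi₀]
        exact (Nat.sub_le _ _).trans (hT.2.1 _)
      | succ i =>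
        rw [length_currentPath_dg h hi₀] at hi
        rw [termNorm_dg_succ h hi₀]
        exact ih i₀ (hT.2.2.2.2 i₀) (Nat.lt_of_succ_lt_succ hi)
    · simp [currentPath_of_not_active h] at hi

/-- A path of maximal length ends at a leaf, where active terms have derivation height `1`. The
known value leaves room for exactly one decrease at the last index, which `stepsPlus_root` exploits.
-/
theorem length_currentPath_le (hR : IsTRS R) (t : Term ar) {T : ProofTree ar} (hT : T.Good R g) :
    (currentPath R t T).length ≤ T.depth + 1 ∧
      ((currentPath R t T).length = T.depth + 1 → termNorm R T t T.depth = .nat 1) := by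
  induction T with
  | leaf P =>
    by_cases h : Active R t (.leaf P)
    · refine ⟨by simp [currentPath, h], fun _ => ?_⟩
      rw [ProofTree.depth, termNorm_leaf_zero h, dheight_leaf hR hT h]
      rfl
    · simp [currentPath_of_not_active h]
  | rp P geq gt T ih =>
    by_cases h : Active R t (.rp P geq gt T)
    · obtain ⟨ih₁, ih₂⟩ := ih hT.2.2.2
      rw [length_currentPath_rp h, ProofTree.depth, termNorm_rp_succ h]
      exact ⟨Nat.succ_le_succ ih₁, fun h => ih₂ (Nat.succ.inj h)⟩
    · simp [currentPath_of_not_active h]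
  | sc P π T ih =>
    by_cases h : Active R t (.sc P π T)
    · obtain ⟨ih₁, ih₂⟩ := ih hT.2.2.2
      rw [length_currentPath_sc h, ProofTree.depth, termNorm_sc_succ h]
      exact ⟨Nat.succ_le_succ ih₁, fun h => ih₂ (Nat.succ.inj h)⟩
    · simp [currentPath_of_not_active h]
  | dg P k Ts ih =>
    by_cases h : Active R t (.dg P k Ts)
    · obtain ⟨i₀, hi₀⟩ := h.exists_isFirstActive hR hT
      obtain ⟨ih₁, ih₂⟩ := ih i₀ (hT.2.2.2.2 i₀)
      have hd : (Ts i₀).depth + 1 ≤ (ProofTree.dg P k Ts).depth :=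
        Finset.le_sup (f := fun i => (Ts i).depth + 1) (Finset.mem_univ i₀)
      rw [length_currentPath_dg h hi₀]
      refine ⟨Nat.succ_le_succ (ih₁.trans hd), fun h' => ?_⟩
      have h₁ : (ProofTree.dg P k Ts).depth = (Ts i₀).depth + 1 := by omega
      rw [h₁, termNorm_dg_succ h hi₀]
      exact ih₂ (by omega)
    · simp [currentPath_of_not_active h]

/-- The comparison with a term that has a defined root but is inactive. The first entry other than
`0` lies on the current path, hence is a positive number or a term, and both exceed `0`. -/
theorem lexGt_zero_or (hR : IsTRS R) {s : Term ar} (hs : RootDefined R s) {T : ProofTree ar}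
    (hT : T.Good R g) (E : NormVal ar → NormVal ar → Prop) (hE : ∀ a, E a a) :
    (∀ k, termNorm R T s k = .nat 0) ∨
      LexGt E (currentPath R s T).length (termNorm R T s) fun _ => .nat 0 := by
  classical
  by_cases h : ∀ k, termNorm R T s k = .nat 0
  · exact .inl h
  · push Not at h
    have hj := Nat.find_spec h
    have hlt : Nat.find h < (currentPath R s T).length := by
      by_contra hle
      exact hj (by rw [termNorm_of_length_le (not_lt.1 hle), normDefault_of_rootDefined hs])
    refine .inr ⟨Nat.find h, hlt, fun k hk => ?_, ?_⟩
    · rw [not_not.1 (Nat.find_min h hk)]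
      exact hE _
    · obtain ⟨f, ts, rfl, -⟩ := hs
      rcases termNorm_cases hR hT hlt with ⟨n, -, e⟩ | ⟨j, e⟩
      · rw [e] at hj ⊢
        exact .nat_nat (Nat.pos_of_ne_zero fun h0 => hj (by rw [h0]))
      · rw [e]
        exact .term_zero _

/-- Dependency pairs simulate root steps. -/
structure IsPairStep (R : Set (Rule ar)) (p : Rule (markedAr ar)) (s w : Term ar) : Prop where
  mem_DP : p ∈ DP R
  exists_subst : ∃ σ, s.sharp = p.lhs.subst σ ∧ w.sharp = p.rhs.subst σ

namespace IsPairStep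

variable {p : Rule (markedAr ar)} {s w : Term ar}

theorem reaches (h : IsPairStep R p s w) : Reaches R s p := by
  obtain ⟨σ, hs, -⟩ := h.exists_subst
  exact ⟨σ, hs ▸ .refl⟩

theorem active (h : IsPairStep R p s w) (hR : IsTRS R) {T : ProofTree ar} (hT : T.Good R g)
    (hp : p ∈ T.pairs) : Active R s T :=
  (active_iff hR hT.pairs_subset).2 ⟨p, hp, h.reaches⟩

theorem step (h : IsPairStep R p s w) {P : Set (Rule (markedAr ar))} (hp : p ∈ P) :
    Step P s.sharp w.sharp := by
  obtain ⟨σ, hs, hw⟩ := h.exists_subst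
  rw [hs, hw]
  exact .root p hp σ

theorem follows (h : IsPairStep R p s w) {q : Rule (markedAr ar)} (hq : Reaches R w q) :
    Follows R p q := by
  obtain ⟨σ, -, hw⟩ := h.exists_subst
  obtain ⟨τ, hτ⟩ := hq
  exact ⟨σ, τ, hw ▸ hτ⟩

theorem relStep (h : IsPairStep R p s w) {P S : Set (Rule (markedAr ar))} (hp : p ∈ P) :
    RelStep P S s.sharp w.sharp :=
  ⟨_, _, .refl, h.step hp, .refl⟩

/-- Entries at leaves and at subterm criterion or dependency graph nodes are never `0` for active
terms. A reduction pair node that removes `p` shows a positive height; one that keeps `p` passes the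
question on to its child. -/
theorem exists_termNorm_ne (h : IsPairStep R p s w) (hR : IsTRS R) {T : ProofTree ar}
    (hT : T.Good R g) (hp : p ∈ T.pairs) : ∃ k, termNorm R T s k ≠ .nat 0 := by
  obtain ⟨f, ts, rfl, -⟩ := h.reaches.exists_app hR h.mem_DP
  induction T with
  | leaf P =>
    have ha := h.active hR hT hp
    refine ⟨0, ?_⟩
    rw [termNorm_leaf_zero ha, dheight_leaf hR hT ha]
    simp
  | rp P geq gt T ih =>
    have ha := h.active hR hT hp
    by_cases hpQ : p ∈ T.pairs
    · obtain ⟨k, hk⟩ := ih hT.2.2.2 hpQ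
      exact ⟨k + 1, by rwa [termNorm_rp_succ ha]⟩
    · refine ⟨0, ?_⟩
      rw [termNorm_rp_zero ha]
      have := toNat_dheight_lt
        (h.relStep (P := P \ T.pairs) (S := plainRules R ∪ T.pairs) ⟨hp, hpQ⟩)
        (ne_top_of_le_ne_top (ENat.natCast_ne_top _) (hT.2.2.1 _ _ le_rfl))
      intro e
      rw [NormVal.nat.injEq] at e
      omega
  | sc P π T ih =>
    have ha := h.active hR hT hp
    obtain ⟨hπ, h'⟩ := ha.simpleProj_sharp hR hT
    exact ⟨0, by simp [termNorm_sc_zero ha (h' ts)]⟩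
  | dg P k Ts ih =>
    have ha := h.active hR hT hp
    obtain ⟨i₀, hi₀⟩ := ha.exists_isFirstActive hR hT
    refine ⟨0, ?_⟩
    rw [termNorm_dg_zero ha, dgRank_eq hR (fun i => (hT.2.2.2.2 i).pairs_subset) hi₀]
    intro e
    rw [NormVal.nat.injEq] at e
    have := i₀.2
    omega

theorem lexGt_of_not_active (h : IsPairStep R p s w) (hR : IsTRS R) (hw : RootDefined R w)
    {T : ProofTree ar} (hT : T.Good R g) (hp : p ∈ T.pairs) (hwT : ¬ Active R w T) :
    LexGt Eq (currentPath R s T).length (termNorm R T s) (termNorm R T w) := by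
  have e : termNorm R T w = fun _ => .nat 0 := funext fun k => by
    rw [termNorm_of_not_active hwT, normDefault_of_rootDefined hw]
  rw [e]
  refine (lexGt_zero_or hR (h.reaches.rootDefined hR h.mem_DP) hT Eq fun _ => rfl).resolve_left
    fun h0 => ?_
  obtain ⟨k, hk⟩ := h.exists_termNorm_ne hR hT hp
  exact hk (h0 k)

/-- At each node the entry drops, or it is unchanged and `p` lies in the child on the path. Where
`w` is inactive, the rest of its norm consists of zeros. -/
theorem lexGt (h : IsPairStep R p s w) (hR : IsTRS R) (hw : RootDefined R w) {T : ProofTree ar}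
    (hT : T.Good R g) (hp : p ∈ T.pairs) :
    LexGt Eq (currentPath R s T).length (termNorm R T s) (termNorm R T w) := by
  induction T with
  | leaf P =>
    by_cases hwT : Active R w (.leaf P)
    · obtain ⟨q, hq, hqw⟩ := (active_iff hR hT.pairs_subset).1 hwT
      exact absurd (h.follows hqw) (hT.2.1 p hp q hq)
    · exact h.lexGt_of_not_active hR hw hT hp hwT
  | rp P geq gt T ih =>
    have ha := h.active hR hT hp
    by_cases hwT : Active R w (.rp P geq gt T)
    · have hfin : dheight (RelStep (P \ T.pairs) (plainRules R ∪ T.pairs)) s.sharp ≠ ⊤ :=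
        ne_top_of_le_ne_top (ENat.natCast_ne_top _) (hT.2.2.1 _ _ le_rfl)
      rw [length_currentPath_rp ha]
      by_cases hpQ : p ∈ T.pairs
      · have hle := toNat_dheight_le_of_step
          (h.step (P := plainRules R ∪ T.pairs) (Or.inr hpQ)) hfin
        rcases hle.lt_or_eq with hlt | heq
        · refine .of_zero ?_
          rw [termNorm_rp_zero ha, termNorm_rp_zero hwT]
          exact .nat_nat hlt
        · refine .of_succ ?_ ?_
          · rw [termNorm_rp_zero ha, termNorm_rp_zero hwT, heq]
          · simp only [termNorm_rp_succ ha, termNorm_rp_succ hwT]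
            exact ih hT.2.2.2 hpQ
      · refine .of_zero ?_
        rw [termNorm_rp_zero ha, termNorm_rp_zero hwT]
        exact .nat_nat (toNat_dheight_lt (h.relStep ⟨hp, hpQ⟩) hfin)
    · exact h.lexGt_of_not_active hR hw hT hp hwT
  | sc P π T ih =>
    have ha := h.active hR hT hp
    by_cases hwT : Active R w (.sc P π T)
    · obtain ⟨a, b, hpa, hpb, hab, hproper⟩ := hT.2.2.1 p hp
      obtain ⟨σ, hsσ, hwσ⟩ := h.exists_subst
      have hs : simpleProj π s.sharp = some (a.subst σ) := hsσ ▸ simpleProj_subst σ hpa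
      have hw : simpleProj π w.sharp = some (b.subst σ) := hwσ ▸ simpleProj_subst σ hpb
      rw [length_currentPath_sc ha]
      -- Pairs that are kept may still shrink the projection; only an unchanged projection requires
      -- a look at the child.
      by_cases hpQ : p ∈ T.pairs ∧ b = a
      · refine .of_succ ?_ ?_
        · rw [termNorm_sc_zero ha hs, termNorm_sc_zero hwT hw, hpQ.2]
        · simp only [termNorm_sc_succ ha, termNorm_sc_succ hwT]
          exact ih hT.2.2.2 hpQ.1
      · refine .of_zero ?_
        rw [termNorm_sc_zero ha hs, termNorm_sc_zero hwT hw]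
        have hba : b.ProperSubterm a := by
          by_cases hpQ' : p ∈ T.pairs
          · exact ⟨hab, fun e => hpQ ⟨hpQ', e⟩⟩
          · exact hproper hpQ'
        exact .term_term (hba.subst σ).unmark
    · exact h.lexGt_of_not_active hR hw hT hp hwT
  | dg P k Ts ih =>
    have ha := h.active hR hT hp
    by_cases hwT : Active R w (.dg P k Ts)
    · have hsub := fun i => (hT.2.2.2.2 i).pairs_subset
      obtain ⟨i, hi⟩ := ha.exists_isFirstActive hR hT
      obtain ⟨j, hj⟩ := hwT.exists_isFirstActive hR hT
      obtain ⟨m, hm⟩ := (hT.2.2.1 p).1 hp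
      obtain ⟨q, hq, hqw⟩ := (active_iff hR (hsub j)).1 hj.1
      -- The successor `m` containing `p` lies between the leftmost active ones of `s` and `w`.
      -- Either the rank drops, or all three coincide and `p` is in the common successor.
      have him : i ≤ m := hi.2 m ((active_iff hR (hsub m)).2 ⟨p, hm, h.reaches⟩)
      have hmj : m ≤ j := hT.2.2.2.1 m j p hm q hq (h.follows hqw)
      rw [length_currentPath_dg ha hi]
      rcases (him.trans hmj).lt_or_eq with hlt | heq
      · refine .of_zero ?_
        rw [termNorm_dg_zero ha, termNorm_dg_zero hwT, dgRank_eq hR hsub hi, dgRank_eq hR hsub hj]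
        have := j.2
        have : (i : ℕ) < j := hlt
        exact .nat_nat (by omega)
      · subst heq
        obtain rfl := le_antisymm him hmj
        refine .of_succ ?_ ?_
        · rw [termNorm_dg_zero ha, termNorm_dg_zero hwT, dgRank_eq hR hsub hi,
            dgRank_eq hR hsub hj]
        · simp only [termNorm_dg_succ ha hi, termNorm_dg_succ hwT hj]
          exact ih i (hT.2.2.2.2 i) hm
    · exact h.lexGt_of_not_active hR hw hT hp hwT

end IsPairStep

theorem isPairStep_of_mem (hR : IsTRS R) {ρ : Rule ar} (hρ : ρ ∈ R) {u : Term ar}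
    (hu : u.Subterm ρ.rhs) (hu' : ¬ u.ProperSubterm ρ.lhs) (hd : RootDefined R u)
    (σ : ℕ → Term ar) :
    IsPairStep R ⟨ρ.lhs.sharp, u.sharp⟩ (ρ.lhs.subst σ) (u.subst σ) := by
  refine ⟨⟨ρ, hρ, u, hu, hu', hd, rfl⟩, fun x => (σ x).plain, ?_, ?_⟩
  · obtain ⟨f, ts, e⟩ := hR.exists_lhs_eq_app hρ
    simp only [e]
    exact Term.sharp_app_subst σ f ts
  · obtain ⟨f, ts, rfl, -⟩ := hd
    exact Term.sharp_app_subst σ f ts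

/-- Consequently a step can move the leftmost active successor only to the right. -/
theorem Active.of_step (hR : IsTRS R) {T : ProofTree ar} (hT : T.Good R g) {s t : Term ar}
    (hst : Step (plainRules R) s.sharp t.sharp) (h : Active R t T) : Active R s T := by
  rw [active_iff hR hT.pairs_subset] at *
  exact h.imp fun p hp => ⟨hp.1, hp.2.of_step hst⟩

theorem rootDefined_app_iff {f : F} {ts us : Fin (ar f) → Term ar} :
    RootDefined R (.app f ts) ↔ RootDefined R (.app f us) := by
  have : ∀ ts us : Fin (ar f) → Term ar, RootDefined R (.app f ts) → RootDefined R (.app f us) := by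
    rintro ts us ⟨f', ts', e, h⟩
    cases e
    exact ⟨f, us, rfl, h⟩
  exact ⟨this ts us, this us ts⟩

/-- The norm decreases weakly in steps below the root. -/
theorem stepEq_or_lexGt (hR : IsTRS R) {f : F} {ts : Fin (ar f) → Term ar} {i : Fin (ar f)}
    {t' : Term ar} (hst : Step R (ts i) t') {T : ProofTree ar} (hT : T.Good R g) :
    (∀ k, NormVal.StepEq R (termNorm R T (.app f ts) k)
        (termNorm R T (.app f (Function.update ts i t')) k)) ∨
      LexGt (NormVal.StepEq R) (currentPath R (.app f ts) T).length (termNorm R T (.app f ts))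
        (termNorm R T (.app f (Function.update ts i t'))) := by
  have hsharp := step_sharp_arg f ts i hst
  -- If the reduct is inactive, its norm is constantly `0` or, for an undefined root, constantly
  -- `⊥`; in the latter case the original term is inactive as well.
  have inactive : ∀ {T : ProofTree ar}, T.Good R g →
      ¬ Active R (.app f (Function.update ts i t')) T →
      (∀ k, NormVal.StepEq R (termNorm R T (.app f ts) k)
        (termNorm R T (.app f (Function.update ts i t')) k)) ∨
      LexGt (NormVal.StepEq R) (currentPath R (.app f ts) T).length (termNorm R T (.app f ts))
        (termNorm R T (.app f (Function.update ts i t'))) := by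
    intro T hT hna
    by_cases hd : RootDefined R (.app f ts)
    · have e : termNorm R T (.app f (Function.update ts i t')) = fun _ => .nat 0 :=
        funext fun k => by
          rw [termNorm_of_not_active hna, normDefault_of_rootDefined (rootDefined_app_iff.1 hd)]
      rw [e]
      refine (lexGt_zero_or hR hd hT _ .refl).imp_left fun h k => ?_
      rw [h k]
      exact .refl _
    · have hns : ¬ Active R (.app f ts) T := fun h => by
        obtain ⟨p, hp, hpt⟩ := (active_iff hR hT.pairs_subset).1 h
        exact hd (hpt.rootDefined hR (hT.pairs_subset hp))
      refine .inl fun k => ?_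
      rw [termNorm_of_not_active hns, termNorm_of_not_active hna,
        normDefault_of_not_rootDefined hd,
        normDefault_of_not_rootDefined (mt rootDefined_app_iff.1 hd)]
      exact .refl _
  induction T with
  | leaf P =>
    by_cases ht : Active R (.app f (Function.update ts i t')) (.leaf P)
    · have hs := ht.of_step hR hT hsharp
      obtain ⟨p, hp, hpt⟩ := (active_iff hR hT.pairs_subset).1 hs
      have hd := hpt.rootDefined hR (hT.pairs_subset hp)
      refine .inl fun k => ?_
      cases k with
      | zero =>
        rw [termNorm_leaf_zero hs, termNorm_leaf_zero ht, dheight_leaf hR hT hs,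
          dheight_leaf hR hT ht]
        exact .refl _
      | succ k =>
        rw [termNorm_leaf_succ hs, termNorm_leaf_succ ht, normDefault_of_rootDefined hd,
          normDefault_of_rootDefined (rootDefined_app_iff.1 hd)]
        exact .refl _
    · exact inactive hT ht
  | rp P geq gt T ih =>
    by_cases ht : Active R (.app f (Function.update ts i t')) (.rp P geq gt T)
    · have hs := ht.of_step hR hT hsharp
      rw [length_currentPath_rp hs]
      have hle := toNat_dheight_le_of_step (R := P \ T.pairs)
        (hsharp.mono (Set.subset_union_left (t := T.pairs)))
        (ne_top_of_le_ne_top (ENat.natCast_ne_top _) (hT.2.2.1 _ _ le_rfl))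
      rcases hle.lt_or_eq with hlt | heq
      · refine .inr (.of_zero ?_)
        rw [termNorm_rp_zero hs, termNorm_rp_zero ht]
        exact .nat_nat hlt
      · have h0 : NormVal.StepEq R (termNorm R (.rp P geq gt T) (.app f ts) 0)
            (termNorm R (.rp P geq gt T) (.app f (Function.update ts i t')) 0) := by
          rw [termNorm_rp_zero hs, termNorm_rp_zero ht, heq]
          exact .refl _
        refine (ih hT.2.2.2).imp (fun h k => ?_) fun h => .of_succ h0 ?_
        · cases k with
          | zero => exact h0
          | succ k =>
            rw [termNorm_rp_succ hs, termNorm_rp_succ ht]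
            exact h k
        · simpa only [termNorm_rp_succ hs, termNorm_rp_succ ht] using h
    · exact inactive hT ht
  | sc P π T ih =>
    by_cases ht : Active R (.app f (Function.update ts i t')) (.sc P π T)
    · have hs := ht.of_step hR hT hsharp
      rw [length_currentPath_sc hs]
      have h0 : NormVal.StepEq R (termNorm R (.sc P π T) (.app f ts) 0)
          (termNorm R (.sc P π T) (.app f (Function.update ts i t')) 0) := by
        obtain ⟨hπ, hproj⟩ := hs.simpleProj_sharp hR hT
        rw [termNorm_sc_zero hs (hproj _), termNorm_sc_zero ht (hproj _), Term.unmark_plain,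
          Term.unmark_plain]
        by_cases hi : ⟨π f, hπ⟩ = i
        · subst hi
          rw [Function.update_self]
          exact .step hst
        · rw [Function.update_of_ne hi]
          exact .refl _
      refine (ih hT.2.2.2).imp (fun h k => ?_) fun h => .of_succ h0 ?_
      · cases k with
        | zero => exact h0
        | succ k =>
          rw [termNorm_sc_succ hs, termNorm_sc_succ ht]
          exact h k
      · simpa only [termNorm_sc_succ hs, termNorm_sc_succ ht] using h
    · exact inactive hT ht
  | dg P n Ts ih =>
    by_cases ht : Active R (.app f (Function.update ts i t')) (.dg P n Ts)
    · have hs := ht.of_step hR hT hsharp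
      have hsub := fun i => (hT.2.2.2.2 i).pairs_subset
      obtain ⟨a, ha⟩ := hs.exists_isFirstActive hR hT
      obtain ⟨b, hb⟩ := ht.exists_isFirstActive hR hT
      have hab : a ≤ b := ha.2 b (hb.1.of_step hR (hT.2.2.2.2 b) hsharp)
      rw [length_currentPath_dg hs ha]
      rcases hab.lt_or_eq with hlt | heq
      · refine .inr (.of_zero ?_)
        rw [termNorm_dg_zero hs, termNorm_dg_zero ht, dgRank_eq hR hsub ha, dgRank_eq hR hsub hb]
        have := b.2
        have : (a : ℕ) < b := hlt
        exact .nat_nat (by omega)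
      · subst heq
        have h0 : NormVal.StepEq R (termNorm R (.dg P n Ts) (.app f ts) 0)
            (termNorm R (.dg P n Ts) (.app f (Function.update ts i t')) 0) := by
          rw [termNorm_dg_zero hs, termNorm_dg_zero ht, dgRank_eq hR hsub ha,
            dgRank_eq hR hsub hb]
          exact .refl _
        refine (ih a (hT.2.2.2.2 a)).imp (fun h k => ?_) fun h => .of_succ h0 ?_
        · cases k with
          | zero => exact h0
          | succ k =>
            rw [termNorm_dg_succ hs ha, termNorm_dg_succ ht hb]
            exact h k
        · simpa only [termNorm_dg_succ hs ha, termNorm_dg_succ ht hb] using h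
    · exact inactive hT ht

end Compare

/-! ### Rewriting in several arguments -/

section Rewriting

variable {F : Type*} {ar : F → ℕ} {R : Set (Rule ar)}

theorem Step.update (f : F) (ts : Fin (ar f) → Term ar) (i : Fin (ar f)) {a b : Term ar}
    (h : Step R a b) :
    Step R (.app f (Function.update ts i a)) (.app f (Function.update ts i b)) := by
  have := Step.arg (R := R) f (Function.update ts i a) i b (by rwa [Function.update_self])
  rwa [Function.update_idem] at this

theorem StepsPlus.update (f : F) (ts : Fin (ar f) → Term ar) (i : Fin (ar f)) {a b : Term ar}
    (h : StepsPlus R a b) :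
    StepsPlus R (.app f (Function.update ts i a)) (.app f (Function.update ts i b)) :=
  Relation.TransGen.lift (fun a => Term.app f (Function.update ts i a))
    (fun _ _ h => Step.update f ts i h) _ _ h

theorem Steps.update (f : F) (ts : Fin (ar f) → Term ar) (i : Fin (ar f)) {a b : Term ar}
    (h : Steps R a b) :
    Steps R (.app f (Function.update ts i a)) (.app f (Function.update ts i b)) :=
  Relation.ReflTransGen.lift (fun a => Term.app f (Function.update ts i a))
    (fun _ _ h => Step.update f ts i h) _ _ h

theorem Steps.app (f : F) {ts us : Fin (ar f) → Term ar} (h : ∀ i, Steps R (ts i) (us i)) :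
    Steps R (.app f ts) (.app f us) := by
  -- `S` collects the positions that have been rewritten already.
  have key : ∀ S : Finset (Fin (ar f)), Steps R (.app f ts) (.app f (S.piecewise us ts)) := by
    intro S
    induction S using Finset.induction_on with
    | empty => rw [Finset.piecewise_empty]; exact .refl
    | insert i S hi ih =>
      rw [Finset.piecewise_insert]
      have := Steps.update (R := R) f (S.piecewise us ts) i (h i)
      have e : Function.update (S.piecewise us ts) i (ts i) = S.piecewise us ts := by
        rw [Function.update_eq_self_iff, Finset.piecewise_eq_of_notMem _ _ _ hi]
      rw [e] at this
      exact ih.trans this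
  simpa using key Finset.univ

theorem StepsPlus.app (f : F) {ts us : Fin (ar f) → Term ar} (h : ∀ i, Steps R (ts i) (us i))
    (i : Fin (ar f)) (hi : StepsPlus R (ts i) (us i)) :
    StepsPlus R (.app f ts) (.app f us) := by
  have := StepsPlus.update (R := R) f ts i hi
  rw [Function.update_eq_self] at this
  refine this.trans_left (Steps.app f fun k => ?_)
  by_cases hk : k = i
  · subst hk; rw [Function.update_self]; exact .refl
  · rw [Function.update_of_ne hk]; exact h k

end Rewriting

/-! ### Derivations with the rules of the simulating system -/

namespace Sim

section

variable {Γ : Type*} {d A : ℕ} {arΓ : Γ → ℕ}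

theorem fT_subst (σ : ℕ → Term (simAr d A arΓ)) (us : Fin d → Term (simAr d A arΓ))
    (xs : Fin A → Term (simAr d A arΓ)) :
    (fT us xs).subst σ = fT (fun m => (us m).subst σ) fun j => (xs j).subst σ :=
  congrArg (Term.app SimSym.f) <| funext fun i => by
    refine Fin.addCases (fun m => ?_) (fun j => ?_) i
    · simp only [Fin.append_left]
    · simp only [Fin.append_right]

theorem zeroT_subst (σ : ℕ → Term (simAr d A arΓ)) :
    (zeroT : Term (simAr d A arΓ)).subst σ = zeroT :=
  congrArg (Term.app SimSym.zero) (funext fun i => i.elim0)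

theorem botT_subst (σ : ℕ → Term (simAr d A arΓ)) :
    (botT : Term (simAr d A arΓ)).subst σ = botT :=
  congrArg (Term.app SimSym.bot) (funext fun i => i.elim0)

theorem cT_subst (σ : ℕ → Term (simAr d A arΓ)) :
    (cT : Term (simAr d A arΓ)).subst σ = cT :=
  congrArg (Term.app SimSym.c) (funext fun i => i.elim0)

theorem zT_subst (σ : ℕ → Term (simAr d A arΓ)) :
    (zT : Term (simAr d A arΓ)).subst σ = zT :=
  congrArg (Term.app SimSym.z) (funext fun i => i.elim0)

theorem succT_subst (σ : ℕ → Term (simAr d A arΓ)) (t : Term (simAr d A arΓ)) :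
    (succT t).subst σ = succT (t.subst σ) := rfl

theorem succT_iterate_subst (σ : ℕ → Term (simAr d A arΓ)) (n : ℕ) (t : Term (simAr d A arΓ)) :
    (succT^[n] t).subst σ = succT^[n] (t.subst σ) := by
  induction n generalizing t with
  | zero => rfl
  | succ n ih => rw [Function.iterate_succ_apply, ih]; rfl

theorem nT_subst (σ : ℕ → Term (simAr d A arΓ)) (xs : Fin A → Term (simAr d A arΓ)) :
    (nT xs).subst σ = nT fun j => (xs j).subst σ := by
  refine congrArg (Term.app SimSym.choice) (funext fun _ => ?_)
  rw [fT_subst]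
  simp only [zeroT_subst]

theorem mT_subst (σ : ℕ → Term (simAr d A arΓ)) (i : Fin d) (us : Fin d → Term (simAr d A arΓ))
    (xs : Fin A → Term (simAr d A arΓ)) (k : ℕ) :
    (mT i us xs k).subst σ = mT i (fun m => (us m).subst σ) (fun j => (xs j).subst σ) k := by
  induction k with
  | zero => simp only [mT, fT_subst, apply_ite (Term.subst σ), nT_subst]
  | succ k ih => simp only [mT, fT_subst, apply_ite (Term.subst σ), nT_subst, ih]

/-- The substitution for the variables of the rules. -/
def ruleSubst (us vs : Fin d → Term (simAr d A arΓ)) (xs ys : Fin A → Term (simAr d A arΓ))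
    (n : ℕ) : Term (simAr d A arΓ) :=
  if h : n < d then us ⟨n, h⟩
  else if h : n - d < d then vs ⟨n - d, h⟩
  else if h : n - 2 * d < A then xs ⟨n - 2 * d, h⟩
  else if h : n - (2 * d + A) < A then ys ⟨n - (2 * d + A), h⟩
  else zeroT

section

variable (us vs : Fin d → Term (simAr d A arΓ)) (xs ys : Fin A → Term (simAr d A arΓ))

theorem uV_subst (m : Fin d) : (uV m).subst (ruleSubst us vs xs ys) = us m := by
  simp [uV, Term.subst, ruleSubst]

theorem vV_subst (m : Fin d) : (vV m).subst (ruleSubst us vs xs ys) = vs m := by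
  simp [vV, Term.subst, ruleSubst]

theorem xV_subst (j : Fin A) : (xV j).subst (ruleSubst us vs xs ys) = xs j := by
  have h₁ : ¬ 2 * d + (j : ℕ) < d := by omega
  have h₂ : ¬ 2 * d + (j : ℕ) - d < d := by omega
  simp [xV, Term.subst, ruleSubst, h₁, h₂]

theorem yV_subst (j : Fin A) : (yV j).subst (ruleSubst us vs xs ys) = ys j := by
  have h₁ : ¬ 2 * d + A + (j : ℕ) < d := by omega
  have h₂ : ¬ 2 * d + A + (j : ℕ) - d < d := by omega
  have h₃ : ¬ 2 * d + A + (j : ℕ) - 2 * d < A := by omega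
  simp [yV, Term.subst, ruleSubst, h₁, h₂, h₃]

theorem update_uV_subst (i : Fin d) (t : Term (simAr d A arΓ)) :
    (fun m => (Function.update uV i t m).subst (ruleSubst us vs xs ys)) =
      Function.update us i (t.subst (ruleSubst us vs xs ys)) := by
  funext m
  rw [Function.apply_update (fun _ t => Term.subst (ruleSubst us vs xs ys) t)]
  simp only [uV_subst]

end

/-- The decrease of an entry of `f` by one application of a rule. -/
inductive Dec : Term (simAr d A arΓ) → Term (simAr d A arΓ) → Prop
  | succ (a : Term (simAr d A arΓ)) : Dec (succT a) a
  | arg (vs : Fin d → Term (simAr d A arΓ)) (ys : Fin A → Term (simAr d A arΓ)) (j : Fin A) :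
      Dec (fT vs ys) (ys j)
  | fT_zero (vs : Fin d → Term (simAr d A arΓ)) (ys : Fin A → Term (simAr d A arΓ)) :
      Dec (fT vs ys) zeroT
  | zero_bot : Dec zeroT botT

theorem num_succ (n : ℕ) : (num (n + 1) : Term (simAr d A arΓ)) = succT (num n) :=
  Function.iterate_succ_apply' _ _ _

theorem dec_num {m n : ℕ} (h : n < m) :
    Relation.TransGen Dec (num m : Term (simAr d A arΓ)) (num n) := by
  induction m, h using Nat.le_induction with
  | base => rw [num_succ]; exact .single (.succ _)
  | succ m _ ih => rw [num_succ]; exact .head (.succ _) ih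

theorem dec_num_bot (m : ℕ) : Relation.TransGen Dec (num m : Term (simAr d A arΓ)) botT := by
  cases m with
  | zero => exact .single .zero_bot
  | succ m => exact (dec_num m.succ_pos).tail .zero_bot

/-- The first `n` entries are given by `us`, the others are still to be chosen. -/
def fillT (n : ℕ) (us : Fin d → Term (simAr d A arΓ)) (xs : Fin A → Term (simAr d A arΓ)) :
    Term (simAr d A arΓ) :=
  fT (fun m => if (m : ℕ) < n then us m else nT xs) xs

theorem mT_zero (i : Fin d) (us : Fin d → Term (simAr d A arΓ))
    (xs : Fin A → Term (simAr d A arΓ)) : mT i us xs 0 = fillT (i + 1) us xs := by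
  simp only [mT, fillT, Fin.le_def, Nat.lt_succ_iff]

theorem mT_succ (i : Fin d) (us : Fin d → Term (simAr d A arΓ))
    (xs : Fin A → Term (simAr d A arΓ)) (k : ℕ) :
    mT i us xs (k + 1) = fillT (i + 1) us fun _ => mT i us xs k := by
  simp only [mT, fillT, Fin.le_def, Nat.lt_succ_iff]

variable {C : ℕ} {gs : Γ} {Rs : Set (Rule (simAr d A arΓ))}

theorem steps_fT {us us' : Fin d → Term (simAr d A arΓ)} {xs xs' : Fin A → Term (simAr d A arΓ)}
    (hu : ∀ m, Steps Rs (us m) (us' m)) (hx : ∀ j, Steps Rs (xs j) (xs' j)) :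
    Steps Rs (fT us xs) (fT us' xs') := by
  refine Steps.app SimSym.f fun i => ?_
  refine Fin.addCases (fun m => ?_) (fun j => ?_) i
  · simpa only [Fin.append_left] using hu m
  · simpa only [Fin.append_right] using hx j

theorem stepsPlus_fT {us us' : Fin d → Term (simAr d A arΓ)}
    {xs xs' : Fin A → Term (simAr d A arΓ)}
    (hu : ∀ m, Steps Rs (us m) (us' m)) (hx : ∀ j, Steps Rs (xs j) (xs' j)) (j : Fin A)
    (hj : StepsPlus Rs (xs j) (xs' j)) : StepsPlus Rs (fT us xs) (fT us' xs') := by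
  refine StepsPlus.app SimSym.f (fun i => ?_) (Fin.natAdd d j) ?_
  · refine Fin.addCases (fun m => ?_) (fun j => ?_) i
    · simpa only [Fin.append_left] using hu m
    · simpa only [Fin.append_right] using hx j
  · simpa only [Fin.append_right] using hj

theorem steps_nT {xs xs' : Fin A → Term (simAr d A arΓ)} (hx : ∀ j, Steps Rs (xs j) (xs' j)) :
    Steps Rs (nT xs) (nT xs') :=
  Steps.app SimSym.choice fun _ => steps_fT (fun _ => .refl) hx

theorem steps_fillT {n : ℕ} {us us' : Fin d → Term (simAr d A arΓ)}
    {xs xs' : Fin A → Term (simAr d A arΓ)}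
    (hu : ∀ m : Fin d, (m : ℕ) < n → Steps Rs (us m) (us' m))
    (hx : ∀ j, Steps Rs (xs j) (xs' j)) : Steps Rs (fillT n us xs) (fillT n us' xs') := by
  refine steps_fT (fun m => ?_) hx
  split
  · exact hu m ‹_›
  · exact steps_nT hx

section

variable (hS : ∀ ρ, SimRule d A C arΓ gs ρ → ρ ∈ Rs)
include hS

theorem step_of_dec (i : Fin d) (us : Fin d → Term (simAr d A arΓ))
    (xs : Fin A → Term (simAr d A arΓ)) {a b : Term (simAr d A arΓ)} (h : Dec a b) :
    Step Rs (fT (Function.update us i a) xs) (mT i (Function.update us i b) xs C) := by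
  cases h with
  | succ =>
    -- The variable at index `i` stands for the predecessor, not for the entry itself.
    have := Step.root _ (hS _ (.r1 i)) (ruleSubst (Function.update us i b) us xs xs)
    simpa only [fT_subst, update_uV_subst, mT_subst, succT_subst, uV_subst, xV_subst,
      Function.update_self, Function.update_idem] using this
  | arg vs ys j =>
    have := Step.root _ (hS _ (.r2 i j)) (ruleSubst us vs xs ys)
    simpa only [fT_subst, update_uV_subst, mT_subst, vV_subst, xV_subst, yV_subst] using this
  | fT_zero vs ys =>
    have := Step.root _ (hS _ (.r3 i)) (ruleSubst us vs xs ys)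
    simpa only [fT_subst, update_uV_subst, mT_subst, vV_subst, xV_subst, yV_subst,
      zeroT_subst] using this
  | zero_bot =>
    have := Step.root _ (hS _ (.r4 i)) (ruleSubst us us xs xs)
    simpa only [fT_subst, update_uV_subst, mT_subst, xV_subst, zeroT_subst, botT_subst] using this

theorem step_size_fT (us : Fin d → Term (simAr d A arΓ)) (xs : Fin A → Term (simAr d A arΓ))
    (j : Fin A) : Step Rs (sizeT (fT us xs)) (timesT (sizeT (xs j))) := by
  have := Step.root _ (hS _ (.r5 j)) (ruleSubst us us xs xs)
  simpa only [sizeT, timesT, Term.subst, fT_subst, uV_subst, xV_subst] using this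

theorem step_size_c : Step Rs (sizeT cT) (num 1) := by
  have := Step.root _ (hS _ .r6) fun _ => zeroT
  simp only [sizeT, Term.subst, cT_subst, succT_subst, zeroT_subst] at this
  exact this

theorem step_times_succ (t : Term (simAr d A arΓ)) :
    Step Rs (timesT (succT t)) (succT^[A] (timesT t)) := by
  have := Step.root _ (hS _ .r7) fun _ => t
  simpa only [timesT, Term.subst, succT_subst, succT_iterate_subst] using this

theorem step_times_zero : Step Rs (timesT zeroT) zeroT := by
  have := Step.root _ (hS _ .r8) fun _ => zeroT
  simpa only [timesT, Term.subst, zeroT_subst] using this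

theorem step_fT_c (us : Fin d → Term (simAr d A arΓ)) (xs : Fin A → Term (simAr d A arΓ)) :
    Step Rs (fT us xs) cT := by
  have := Step.root _ (hS _ .r9) (ruleSubst us us xs xs)
  simpa only [fT_subst, uV_subst, xV_subst, cT_subst] using this

theorem step_fT_arg (us : Fin d → Term (simAr d A arΓ)) (xs : Fin A → Term (simAr d A arΓ))
    (j : Fin A) : Step Rs (fT us xs) (xs j) := by
  have := Step.root _ (hS _ (.r10 j)) (ruleSubst us us xs xs)
  simpa only [fT_subst, uV_subst, xV_subst] using this

/-- No entry of `fillT 0 us` comes from `us`, so `us` can be taken to be the norm that is to be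
reached. -/
theorem step_h (us : Fin d → Term (simAr d A arΓ)) (t : Term (simAr d A arΓ)) :
    Step Rs (hT t) (fillT 0 us fun _ => t) := by
  have := Step.root _ (hS _ .r11) fun _ => t
  simpa only [hT, fillT, fT_subst, nT_subst, Term.subst, Nat.not_lt_zero, if_false] using this

theorem step_z (us : Fin d → Term (simAr d A arΓ)) : Step Rs zT (fillT 0 us fun _ => cT) := by
  have := Step.root _ (hS _ .r12) fun _ => zeroT
  simpa only [fillT, fT_subst, nT_subst, zT_subst, cT_subst, Nat.not_lt_zero, if_false] using this

theorem step_nT_arg (xs : Fin A → Term (simAr d A arΓ)) (j : Fin A) :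
    Step Rs (nT xs) (xs j) := by
  have := Step.root _ (hS _ (.r13 j)) (ruleSubst (fun _ => zeroT) (fun _ => zeroT) xs xs)
  simpa only [nT, choiceT, Term.subst, fT_subst, uV_subst, xV_subst] using this

theorem step_nT_aux (xs : Fin A → Term (simAr d A arΓ)) :
    Step Rs (nT xs) (auxT gs (sizeT (fT (fun _ => zeroT) xs))) :=
  Step.root _ (hS _ .r14) fun _ => fT (fun _ => zeroT) xs

theorem step_nT_bot (xs : Fin A → Term (simAr d A arΓ)) : Step Rs (nT xs) botT := by
  have := Step.root _ (hS _ .r15) fun _ => fT (fun _ => zeroT) xs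
  simp only [choiceT, Term.subst, botT_subst] at this
  exact this

theorem steps_mT_arg (i : Fin d) (us : Fin d → Term (simAr d A arΓ))
    (xs : Fin A → Term (simAr d A arΓ)) (k : ℕ) (j : Fin A) :
    Steps Rs (mT i us xs k) (xs j) := by
  induction k with
  | zero => exact .single (step_fT_arg hS _ xs j)
  | succ k ih => exact .head (step_fT_arg hS _ (fun _ => mT i us xs k) j) ih

/-- Nested copies that are not needed collapse by rule 10 to the arguments inside them. -/
theorem steps_mT_fillT (i : Fin d) (us : Fin d → Term (simAr d A arΓ))
    (xs : Fin A → Term (simAr d A arΓ)) (k : ℕ) :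
    Steps Rs (mT i us xs k) (fillT (i + 1) us xs) := by
  cases k with
  | zero => rw [mT_zero]; exact .refl
  | succ k =>
    rw [mT_succ]
    exact steps_fillT (fun _ _ => .refl) fun j => steps_mT_arg hS i us xs k j

/-- After each decrease the nested copies are collapsed. The later entries are then `N` already, so
resetting them again changes nothing. -/
theorem stepsPlus_of_dec (i : Fin d) (us : Fin d → Term (simAr d A arΓ))
    (xs : Fin A → Term (simAr d A arΓ)) {a b : Term (simAr d A arΓ)}
    (h : Relation.TransGen Dec a b) :
    StepsPlus Rs (fT (Function.update us i a) xs)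
      (fillT (i + 1) (Function.update us i b) xs) := by
  have key : ∀ (us : Fin d → Term (simAr d A arΓ)) {a b : Term (simAr d A arΓ)}, Dec a b →
      StepsPlus Rs (fT (Function.update us i a) xs)
        (fillT (i + 1) (Function.update us i b) xs) := fun us a b h =>
    .head' (step_of_dec hS i us xs h) (steps_mT_fillT hS i _ xs C)
  induction h with
  | single h => exact key us h
  | @tail b c _ h ih =>
    have h' := key (fun m => if (m : ℕ) < i + 1 then us m else nT xs) h
    have e₁ : fT (Function.update (fun m : Fin d => if (m : ℕ) < i + 1 then us m else nT xs) i b)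
        xs = fillT (i + 1) (Function.update us i b) xs := by
      refine congrArg (fT · xs) (funext fun m => ?_)
      by_cases hm : m = i
      · subst hm; simp
      · simp only [Function.update_of_ne hm]
    have e₂ : fillT (i + 1)
        (Function.update (fun m : Fin d => if (m : ℕ) < i + 1 then us m else nT xs) i c) xs =
        fillT (i + 1) (Function.update us i c) xs := by
      refine congrArg (fT · xs) (funext fun m => ?_)
      by_cases hm : m = i
      · subst hm; simp
      · simp only [Function.update_of_ne hm]
        split <;> rfl
    rw [e₁, e₂] at h'
    exact ih.trans h'

theorem steps_times_num (n : ℕ) : Steps Rs (timesT (num n)) (num (A * n)) := by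
  induction n with
  | zero => exact .single (step_times_zero hS)
  | succ n ih =>
    rw [num_succ]
    refine .head (step_times_succ hS _) ?_
    have key : ∀ (k : ℕ) {a b : Term (simAr d A arΓ)}, Steps Rs a b →
        Steps Rs (succT^[k] a) (succT^[k] b) := by
      intro k a b h
      induction k with
      | zero => exact h
      | succ k ih =>
        rw [Function.iterate_succ_apply', Function.iterate_succ_apply']
        exact Steps.app SimSym.succ fun _ => ih
    have e : (num (A * (n + 1)) : Term (simAr d A arΓ)) = succT^[A] (num (A * n)) := by
      rw [num, num, ← Function.iterate_add_apply]
      congr 1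
      ring
    rw [e]
    exact key A ih

end

end

end Sim

theorem Step.vars_subset {F : Type*} {ar : F → ℕ} {R : Set (Rule ar)} (hR : IsTRS R)
    {s t : Term ar} (h : Step R s t) : t.vars ⊆ s.vars := by
  induction h with
  | root ρ hρ σ =>
    rw [Term.vars_subst, Term.vars_subst]
    exact Set.biUnion_subset_biUnion_left (hR ρ hρ).2
  | arg f ts i t' _ ih =>
    simp only [Term.vars]
    refine Set.iUnion_subset fun k => ?_
    by_cases hk : k = i
    · subst hk
      rw [Function.update_self]
      exact ih.trans (Set.subset_iUnion (fun i => (ts i).vars) k)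
    · rw [Function.update_of_ne hk]
      exact Set.subset_iUnion (fun i => (ts i).vars) k

theorem Step.isGround {F : Type*} {ar : F → ℕ} {R : Set (Rule ar)} (hR : IsTRS R)
    {s t : Term ar} (h : Step R s t) (hs : s.IsGround) : t.IsGround :=
  Set.subset_eq_empty (h.vars_subset hR) hs

/-! ### Simulation of rewrite steps on translated terms -/

section Simulation

variable {F : Type*} {ar : F → ℕ} {R : Set (Rule ar)} {PT : ProofTree ar} {g : ℕ → ℕ} {A : ℕ}
  {Γ : Type*} {arΓ : Γ → ℕ}

open Sim

/-- The translation of the values of norms. -/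
noncomputable def trVal (R : Set (Rule ar)) (PT : ProofTree ar) (A : ℕ) (arΓ : Γ → ℕ) :
    NormVal ar → Term (simAr (PT.depth + 1) A arΓ)
  | .bot => botT
  | .nat n => num n
  | .term u => tr R PT A arΓ u

noncomputable def trNorm (R : Set (Rule ar)) (PT : ProofTree ar) (A : ℕ) (arΓ : Γ → ℕ)
    (t : Term ar) (i : Fin (PT.depth + 1)) : Term (simAr (PT.depth + 1) A arΓ) :=
  trVal R PT A arΓ (termNorm R PT t i)

noncomputable def trArgs (R : Set (Rule ar)) (PT : ProofTree ar) (A : ℕ) (arΓ : Γ → ℕ) :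
    Term ar → Fin A → Term (simAr (PT.depth + 1) A arΓ)
  | .var _, _ => cT
  | .app f ts, j => if h : (j : ℕ) < ar f then tr R PT A arΓ (ts ⟨j, h⟩) else cT

theorem tr_app (f : F) (ts : Fin (ar f) → Term ar) :
    tr R PT A arΓ (.app f ts) =
      fT (trNorm R PT A arΓ (.app f ts)) (trArgs R PT A arΓ (.app f ts)) := by
  rw [tr]
  refine congrArg (fT · _) (funext fun i => ?_)
  rw [trNorm]
  split <;> rename_i h <;> rw [h] <;> rfl

theorem Term.IsGround.tr_eq {t : Term ar} (h : t.IsGround) :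
    tr R PT A arΓ t = fT (trNorm R PT A arΓ t) (trArgs R PT A arΓ t) := by
  obtain ⟨f, ts, rfl⟩ := h.exists_app
  exact tr_app f ts

/-- The properties of the simulating system and of its parameters on which the simulation
depends. -/
structure IsSimulation (R : Set (Rule ar)) (PT : ProofTree ar) (g : ℕ → ℕ) (A C : ℕ) (gs : Γ)
    (Rs : Set (Rule (simAr (PT.depth + 1) A arΓ))) : Prop where
  isTRS : IsTRS R
  pairs_eq : PT.pairs = DP R
  good : PT.Good R g
  mono : Monotone g
  arity_le : ∀ f, ar f ≤ A
  ne_one : A ≠ 1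
  rhs_depth_le : ∀ ρ ∈ R, ρ.rhs.depth ≤ C
  rules : ∀ ρ, SimRule (PT.depth + 1) A C arΓ gs ρ → ρ ∈ Rs
  eval : ∀ n, Steps Rs (auxT gs (num n)) (num (g n))

namespace IsSimulation

variable {C : ℕ} {gs : Γ} {Rs : Set (Rule (simAr (PT.depth + 1) A arΓ))}

section

variable (H : IsSimulation R PT g A C gs Rs)
include H

theorem steps_tr_c (t : Term ar) : Steps Rs (tr R PT A arΓ t) cT := by
  cases t with
  | var x => rw [tr]; exact .refl
  | app f ts => rw [tr_app]; exact .single (step_fT_c H.rules _ _)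

theorem steps_trArgs_c (t : Term ar) (j : Fin A) : Steps Rs (trArgs R PT A arΓ t j) cT := by
  cases t with
  | var x => exact .refl
  | app f ts =>
    rw [trArgs]
    split
    · exact H.steps_tr_c _
    · exact .refl

theorem step_tr_arg (f : F) (ts : Fin (ar f) → Term ar) (i : Fin (ar f)) :
    Step Rs (tr R PT A arΓ (.app f ts)) (tr R PT A arΓ (ts i)) := by
  rw [tr_app]
  have := step_fT_arg H.rules (trNorm R PT A arΓ (.app f ts)) (trArgs R PT A arΓ (.app f ts))
    ⟨i, i.2.trans_le (H.arity_le f)⟩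
  rwa [trArgs, dif_pos i.2] at this

theorem steps_tr_subterm {s t : Term ar} (h : s.Subterm t) :
    Steps Rs (tr R PT A arΓ t) (tr R PT A arΓ s) := by
  induction h with
  | refl => exact .refl
  | arg f ts i _ ih => exact .head (H.step_tr_arg f ts i) ih

theorem dec_tr_arg (f : F) (ts : Fin (ar f) → Term ar) (i : Fin (ar f)) :
    Dec (tr R PT A arΓ (.app f ts)) (tr R PT A arΓ (ts i)) := by
  rw [tr_app]
  have := Dec.arg (trNorm R PT A arΓ (.app f ts)) (trArgs R PT A arΓ (.app f ts))
    ⟨i, i.2.trans_le (H.arity_le f)⟩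
  rwa [trArgs, dif_pos i.2] at this

theorem dec_tr_subterm {s t : Term ar} (h : s.Subterm t) :
    Relation.ReflTransGen Dec (tr R PT A arΓ t) (tr R PT A arΓ s) := by
  induction h with
  | refl => exact .refl
  | arg f ts i _ ih => exact .head (H.dec_tr_arg f ts i) ih

/-- Groundness matters for terms that drop to `0` or `⊥`: a variable would be translated to `c`, to
which rule 3 does not apply. -/
theorem dec_of_gt {a b : NormVal ar} (h : a.Gt b) (ha : ∀ u, a = .term u → u.IsGround) :
    Relation.TransGen Dec (trVal R PT A arΓ a) (trVal R PT A arΓ b) := by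
  cases h with
  | nat_nat h => exact dec_num h
  | nat_bot m => exact dec_num_bot m
  | term_term h =>
    obtain ⟨f, ts, i, rfl, hs⟩ := Term.properSubterm_iff.1 h
    exact .head' (H.dec_tr_arg f ts i) (H.dec_tr_subterm hs)
  | term_zero u =>
    rw [trVal, trVal, (ha u rfl).tr_eq]
    exact .single (.fT_zero _ _)
  | term_bot u =>
    rw [trVal, trVal, (ha u rfl).tr_eq]
    exact .tail (.single (.fT_zero _ _)) .zero_bot

/-- With M the size of a largest argument, the size is at most 1 + A·M. The stronger bound survives
the induction because 2 + A·M ≤ A·(M + 1) if A ≥ 2. For A = 0 all ground terms are constants and m =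
1 suffices; for A = 1 `times` would not increase anything. -/
theorem exists_steps_size {t : Term ar} (ht : t.IsGround)
    (us : Fin (PT.depth + 1) → Term (simAr (PT.depth + 1) A arΓ)) :
    ∃ m, t.size ≤ m ∧ (2 ≤ A → t.size + 1 ≤ m) ∧
      Steps Rs (sizeT (fT us (trArgs R PT A arΓ t))) (num m) := by
  have hsize : ∀ {a b : Term (simAr (PT.depth + 1) A arΓ)}, Steps Rs a b →
      Steps Rs (sizeT a) (sizeT b) := fun h => Steps.app SimSym.size fun _ => h
  have htimes : ∀ {a b : Term (simAr (PT.depth + 1) A arΓ)}, Steps Rs a b →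
      Steps Rs (timesT a) (timesT b) := fun h => Steps.app SimSym.times fun _ => h
  induction t generalizing us with
  | var x => simp [Term.IsGround, Term.vars] at ht
  | app f ts ih =>
    have hf := H.arity_le f
    have hA := H.ne_one
    rcases Nat.eq_zero_or_pos (ar f) with h0 | hpos
    · have hs : (Term.app f ts).size = 1 := by
        have : IsEmpty (Fin (ar f)) := h0 ▸ Fin.isEmpty
        simp [Term.size]
      rcases Nat.eq_zero_or_pos A with hA0 | hApos
      · refine ⟨1, hs.le, fun h => by omega, ?_⟩
        exact (hsize (.single (step_fT_c H.rules _ _))).tail (step_size_c H.rules)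
      · refine ⟨A * 1, by omega, fun h => by omega, ?_⟩
        have e : trArgs R PT A arΓ (.app f ts) ⟨0, hApos⟩ = cT := dif_neg (by simp [h0])
        have h₁ := step_size_fT H.rules us (trArgs R PT A arΓ (.app f ts)) ⟨0, hApos⟩
        rw [e] at h₁
        exact .head h₁ ((htimes (.single (step_size_c H.rules))).trans
          (steps_times_num H.rules 1))
    · have hne : Nonempty (Fin (ar f)) := ⟨⟨0, hpos⟩⟩
      obtain ⟨i, -, hi⟩ := Finset.exists_max_image Finset.univ (fun i => (ts i).size)
        Finset.univ_nonempty
      obtain ⟨m, -, hm, hsteps⟩ := ih i (ht.arg i) (trNorm R PT A arΓ (ts i))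
      have hA2 : 2 ≤ A := by omega
      have hm := hm hA2
      have hs : (Term.app f ts).size + 1 ≤ A * m := by
        have h₁ : ∑ i, (ts i).size ≤ ar f * (ts i).size := by
          simpa using Finset.sum_le_card_nsmul Finset.univ (fun i => (ts i).size) _ hi
        have h₂ : ar f * (ts i).size ≤ A * (ts i).size := Nat.mul_le_mul_right _ hf
        have h₃ : A * ((ts i).size + 1) ≤ A * m := Nat.mul_le_mul_left _ hm
        rw [Nat.mul_add] at h₃
        simp only [Term.size]
        omega
      refine ⟨A * m, by omega, fun _ => hs, ?_⟩
      have e : trArgs R PT A arΓ (.app f ts) ⟨i, i.2.trans_le hf⟩ = tr R PT A arΓ (ts i) :=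
        dif_pos i.2
      have h₁ := step_size_fT H.rules us (trArgs R PT A arΓ (.app f ts)) ⟨i, i.2.trans_le hf⟩
      rw [e, (ht.arg i).tr_eq] at h₁
      exact .head h₁ ((htimes hsteps).trans (steps_times_num H.rules m))

theorem exists_steps_nT_num {t : Term ar} (ht : t.IsGround) :
    ∃ n, g t.size ≤ n ∧ Steps Rs (nT (trArgs R PT A arΓ t)) (num n) := by
  obtain ⟨m, hm, -, h⟩ := H.exists_steps_size ht fun _ => zeroT
  refine ⟨g m, H.mono hm, .head (step_nT_aux H.rules _) (Relation.ReflTransGen.trans ?_ (H.eval m))⟩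
  exact Steps.app (SimSym.aux gs) fun _ => h

theorem termNorm_eq_term_imp {f : F} {ts : Fin (ar f) → Term ar} {i : ℕ} {u : Term ar}
    (h : termNorm R PT (.app f ts) i = .term u) : ∃ j, u = ts j := by
  rcases lt_or_ge i (currentPath R (.app f ts) PT).length with hi | hi
  · rcases termNorm_cases H.isTRS H.good hi with ⟨n, -, e⟩ | ⟨j, e⟩
    · rw [e] at h; cases h
    · rw [e] at h; cases h; exact ⟨j, rfl⟩
  · rw [termNorm_of_length_le hi, normDefault] at h
    split at h <;> cases h

theorem isGround_of_termNorm_eq {t : Term ar} (ht : t.IsGround) {i : ℕ} {u : Term ar}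
    (h : termNorm R PT t i = .term u) : u.IsGround := by
  obtain ⟨f, ts, rfl⟩ := ht.exists_app
  obtain ⟨j, rfl⟩ := H.termNorm_eq_term_imp h
  exact ht.arg j

/-- Numerical entries are only bounded by g of the size, so `N` may overshoot; the surplus has to be
removed later by rule 1. Terms are obtained by rule 13 and ⊥ by rule 15. -/
theorem steps_nT_trNorm {t : Term ar} (ht : t.IsGround) (i : Fin (PT.depth + 1)) :
    Steps Rs (nT (trArgs R PT A arΓ t)) (trNorm R PT A arΓ t i) ∨
      ∃ m n, n < m ∧ trNorm R PT A arΓ t i = num n ∧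
        Steps Rs (nT (trArgs R PT A arΓ t)) (num m) := by
  obtain ⟨f, ts, rfl⟩ := ht.exists_app
  obtain ⟨m, hm, hsteps⟩ := H.exists_steps_nT_num ht
  have nat : ∀ n ≤ m, trNorm R PT A arΓ (.app f ts) i = num n →
      Steps Rs (nT (trArgs R PT A arΓ (.app f ts))) (trNorm R PT A arΓ (.app f ts) i) ∨
      ∃ m n, n < m ∧ trNorm R PT A arΓ (.app f ts) i = num n ∧
        Steps Rs (nT (trArgs R PT A arΓ (.app f ts))) (num m) := by
    intro n hn e
    rcases hn.lt_or_eq with h | rfl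
    · exact .inr ⟨m, n, h, e, hsteps⟩
    · exact .inl (e ▸ hsteps)
  rcases lt_or_ge (i : ℕ) (currentPath R (.app f ts) PT).length with hi | hi
  · rcases termNorm_cases H.isTRS H.good hi with ⟨n, hn, e⟩ | ⟨j, e⟩
    · exact nat n (hn.trans hm) (by rw [trNorm, e, trVal])
    · left
      rw [trNorm, e, trVal]
      have := step_nT_arg H.rules (trArgs R PT A arΓ (.app f ts)) ⟨j, j.2.trans_le (H.arity_le f)⟩
      rw [trArgs, dif_pos j.2] at this
      exact .single this
  · by_cases hd : RootDefined R (.app f ts)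
    · refine nat 0 (Nat.zero_le _) ?_
      rw [trNorm, termNorm_of_length_le hi, normDefault_of_rootDefined hd, trVal]
    · left
      rw [trNorm, termNorm_of_length_le hi, normDefault_of_not_rootDefined hd, trVal]
      exact .single (step_nT_bot H.rules _)

/-- Entries are settled from left to right, since lowering an entry resets the later ones to `N`. -/
theorem steps_fillT_tr {t : Term ar} (ht : t.IsGround) {n : ℕ} (hn : n ≤ PT.depth + 1) :
    Steps Rs (fillT n (trNorm R PT A arΓ t) (trArgs R PT A arΓ t)) (tr R PT A arΓ t) := by
  induction hn using Nat.decreasingInduction with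
  | self =>
    rw [ht.tr_eq, fillT]
    simp only [Fin.is_lt, if_true]
    exact .refl
  | of_succ n hn ih =>
    refine Relation.ReflTransGen.trans ?_ ih
    have split : ∀ {a : Term (simAr (PT.depth + 1) A arΓ)},
        Steps Rs (nT (trArgs R PT A arΓ t)) a →
        Steps Rs (fillT n (trNorm R PT A arΓ t) (trArgs R PT A arΓ t))
          (fT (Function.update (fun m : Fin (PT.depth + 1) => if (m : ℕ) < n then
            trNorm R PT A arΓ t m else nT (trArgs R PT A arΓ t)) ⟨n, hn⟩ a)
            (trArgs R PT A arΓ t)) := by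
      intro a ha
      refine steps_fT (fun m => ?_) fun _ => .refl
      by_cases hm : m = ⟨n, hn⟩
      · subst hm
        simpa using ha
      · rw [Function.update_of_ne hm]
        exact .refl
    have fill : ∀ {b : Term (simAr (PT.depth + 1) A arΓ)}, trNorm R PT A arΓ t ⟨n, hn⟩ = b →
        ∀ m : Fin (PT.depth + 1), (m : ℕ) < n + 1 →
          Function.update (fun m : Fin (PT.depth + 1) => if (m : ℕ) < n then
            trNorm R PT A arΓ t m else nT (trArgs R PT A arΓ t)) ⟨n, hn⟩ b m =
          trNorm R PT A arΓ t m := by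
      rintro _ rfl m hm
      by_cases hmn : m = ⟨n, hn⟩
      · subst hmn
        rw [Function.update_self]
      · rw [Function.update_of_ne hmn, if_pos]
        exact lt_of_le_of_ne (Nat.lt_succ_iff.1 hm) fun e => hmn (Fin.ext e)
    rcases H.steps_nT_trNorm ht ⟨n, hn⟩ with h | ⟨p, q, hqp, e, h⟩
    · refine (split h).trans (steps_fT (fun m => ?_) fun _ => .refl)
      by_cases hm : (m : ℕ) < n + 1
      · rw [fill rfl m hm, if_pos hm]
        exact .refl
      · rw [Function.update_of_ne (by rintro rfl; simp at hm), if_neg hm, if_neg (by omega)]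
        exact .refl
    · refine (split h).trans ((stepsPlus_of_dec H.rules ⟨n, hn⟩ _ _ (dec_num hqp)).to_reflTransGen.trans
        (steps_fillT (fun m hm => ?_) fun _ => .refl))
      rw [fill e m hm]
      exact .refl

/-- After the decrease at `j`, the later entries are recovered from `N`. The arguments must be those
of `t` beforehand, because `N` is evaluated on them. -/
theorem stepsPlus_fT_tr {t : Term ar} (ht : t.IsGround)
    {us : Fin (PT.depth + 1) → Term (simAr (PT.depth + 1) A arΓ)} (j : Fin (PT.depth + 1))
    (hlt : ∀ k < j, Steps Rs (us k) (trNorm R PT A arΓ t k))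
    (hj : Relation.TransGen Dec (us j) (trNorm R PT A arΓ t j)) :
    StepsPlus Rs (fT us (trArgs R PT A arΓ t)) (tr R PT A arΓ t) := by
  have h₁ := stepsPlus_of_dec H.rules j us (trArgs R PT A arΓ t) hj
  rw [Function.update_eq_self] at h₁
  refine h₁.trans_left (Relation.ReflTransGen.trans (steps_fillT (fun m hm => ?_) fun _ => .refl)
    (H.steps_fillT_tr ht (Nat.succ_le_of_lt j.2)))
  by_cases hmj : m = j
  · subst hmj
    rw [Function.update_self]
    exact .refl
  · rw [Function.update_of_ne hmj]
    exact hlt m (lt_of_le_of_ne (Nat.lt_succ_iff.1 hm) hmj)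

/-- The entries up to index `i` can be decreased to the norm of `t`. -/
theorem steps_fillT_tr_of_le {t : Term ar} (ht : t.IsGround)
    {us : Fin (PT.depth + 1) → Term (simAr (PT.depth + 1) A arΓ)} {i j : Fin (PT.depth + 1)}
    (hji : j ≤ i) (hlt : ∀ k < j, us k = trNorm R PT A arΓ t k)
    (hj : Relation.TransGen Dec (us j) (trNorm R PT A arΓ t j) ∨
      j = i ∧ us j = trNorm R PT A arΓ t j) :
    Steps Rs (fillT (i + 1) us (trArgs R PT A arΓ t)) (tr R PT A arΓ t) := by
  rcases hj with hj | ⟨rfl, hj⟩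
  · refine (H.stepsPlus_fT_tr ht j (fun k hk => ?_) ?_).to_reflTransGen
    · have : (k : ℕ) < i + 1 := Nat.lt_succ_of_le (hk.le.trans hji)
      rw [if_pos this, hlt k hk]
      exact .refl
    · have : (j : ℕ) < i + 1 := Nat.lt_succ_of_le hji
      rwa [if_pos this]
  · refine Relation.ReflTransGen.trans (steps_fillT (fun m hm => ?_) fun _ => .refl)
      (H.steps_fillT_tr ht (Nat.succ_le_of_lt j.2))
    rcases (show m ≤ j from Nat.lt_succ_iff.1 hm).lt_or_eq with h | rfl
    · rw [hlt m h]; exact .refl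
    · rw [hj]; exact .refl

theorem steps_mT_tr_properSubterm (i : Fin (PT.depth + 1))
    (us : Fin (PT.depth + 1) → Term (simAr (PT.depth + 1) A arΓ)) {s t : Term ar}
    (h : s.ProperSubterm t) (m : ℕ) :
    Steps Rs (mT i us (trArgs R PT A arΓ t) m) (tr R PT A arΓ s) := by
  obtain ⟨f, ts, k, rfl, hk⟩ := Term.properSubterm_iff.1 h
  refine Relation.ReflTransGen.trans
    (steps_mT_arg H.rules i us _ m ⟨k, k.2.trans_le (H.arity_le f)⟩) ?_
  rw [trArgs, dif_pos k.2]
  exact H.steps_tr_subterm hk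

/-- The right-hand side of a rule is built inside of `mT`. -/
theorem steps_mT_tr {ρ : Rule ar} (hρ : ρ ∈ R) (σ : ℕ → Term ar) (i : Fin (PT.depth + 1))
    (us : Fin (PT.depth + 1) → Term (simAr (PT.depth + 1) A arΓ))
    (hus : ∀ u : Term ar, u.Subterm ρ.rhs → ¬ u.ProperSubterm ρ.lhs →
      Steps Rs (fillT (i + 1) us (trArgs R PT A arΓ (u.subst σ))) (tr R PT A arΓ (u.subst σ)))
    {u : Term ar} (hu : u.Subterm ρ.rhs) {m : ℕ} (hm : u.depth ≤ m) :
    Steps Rs (mT i us (trArgs R PT A arΓ (ρ.lhs.subst σ)) m) (tr R PT A arΓ (u.subst σ)) := by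
  induction u generalizing m with
  | var x =>
    have hx : Term.ProperSubterm (.var x) ρ.lhs := by
      refine ⟨Term.subterm_var ((H.isTRS ρ hρ).2 (hu.vars_subset (Set.mem_singleton x))),
        fun e => (H.isTRS ρ hρ).1 x e.symm⟩
    exact H.steps_mT_tr_properSubterm i us (hx.subst σ) m
  | app f' ts' ih =>
    by_cases hl : Term.ProperSubterm (.app f' ts') ρ.lhs
    · exact H.steps_mT_tr_properSubterm i us (hl.subst σ) m
    · have hdepth : ∀ k, (ts' k).depth + 1 ≤ m := fun k =>
        (Finset.le_sup (f := fun k => (ts' k).depth + 1) (Finset.mem_univ k)).trans hm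
      -- The arguments are built first, with the entries of the root left untouched; then these are
      -- lowered to the norm.
      refine Relation.ReflTransGen.trans ?_ (hus _ hu hl)
      cases m with
      -- Depth `0` leaves no genuine arguments, so every position is padding and becomes `c`.
      | zero =>
        rw [mT_zero]
        refine steps_fillT (fun _ _ => .refl) fun j => ?_
        rw [Term.subst, trArgs, dif_neg]
        · exact H.steps_trArgs_c _ j
        · intro h
          have := hdepth ⟨j, h⟩
          omega
      | succ m =>
        rw [mT_succ]
        refine steps_fillT (fun _ _ => .refl) fun j => ?_
        rw [Term.subst, trArgs]
        split
        · rename_i h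
          exact ih ⟨j, h⟩ ((Term.Subterm.arg f' ts' _ (.refl _)).trans hu)
            (Nat.le_of_succ_le_succ (hdepth ⟨j, h⟩))
        · cases m with
          | zero => exact .single (step_fT_c H.rules _ _)
          | succ m => exact .single (step_fT_c H.rules _ _)

theorem not_rootDefined_trNorm {t : Term ar} (h : ¬ RootDefined R t) (i : Fin (PT.depth + 1)) :
    trNorm R PT A arΓ t i = botT := by
  have hna : ¬ Active R t PT := fun ha => by
    obtain ⟨p, hp, hpt⟩ := (active_iff H.isTRS H.good.pairs_subset).1 ha
    exact h (hpt.rootDefined H.isTRS (H.good.pairs_subset hp))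
  rw [trNorm, termNorm_of_not_active hna, normDefault_of_not_rootDefined h, trVal]

theorem rootDefined_lhs {ρ : Rule ar} (hρ : ρ ∈ R) (σ : ℕ → Term ar) :
    RootDefined R (ρ.lhs.subst σ) := by
  obtain ⟨f, ts, e⟩ := H.isTRS.exists_lhs_eq_app hρ
  exact ⟨f, fun i => (ts i).subst σ, by rw [e]; rfl, ρ, hρ, ts, e⟩

/-- One rule application serves all subterms u of the right-hand side, though their norms may drop
at different indices `j`. It lowers an entry `i` that is not before any of these. If `j < i`, this
does no harm, because the further decrease at `j` resets entry `i`. -/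
theorem stepsPlus_root {ρ : Rule ar} (hρ : ρ ∈ R) (σ : ℕ → Term ar)
    (hl : (ρ.lhs.subst σ).IsGround) :
    StepsPlus Rs (tr R PT A arΓ (ρ.lhs.subst σ)) (tr R PT A arΓ (ρ.rhs.subst σ)) := by
  set s := ρ.lhs.subst σ with hs
  have hd : RootDefined R s := H.rootDefined_lhs hρ σ
  obtain ⟨hlen, hlast⟩ := length_currentPath_le H.isTRS s H.good
  have hground : ∀ {i : ℕ} u, termNorm R PT s i = .term u → u.IsGround := fun u h =>
    H.isGround_of_termNorm_eq hl h
  -- The entry at index `i` is the last one that matters for `s`.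
  obtain ⟨i, b, hdec, hb, hi, hib⟩ : ∃ (i : Fin (PT.depth + 1)) (b : NormVal ar),
      Dec (trNorm R PT A arΓ s i) (trVal R PT A arΓ b) ∧
      (b = .bot ∨ b = .nat 0) ∧ (currentPath R s PT).length ≤ i + 1 ∧
      (i < (currentPath R s PT).length → termNorm R PT s i = .nat 1 ∧ b = .nat 0) := by
    -- On a short path the first entry beyond it is `0` and is lowered to `⊥`; on a path of maximal
    -- length the last entry is `1` and is lowered to `0`.
    rcases hlen.lt_or_eq with h | h
    · refine ⟨⟨_, h⟩, .bot, ?_, .inl rfl, Nat.le_succ _, fun h' => absurd h' (lt_irrefl _)⟩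
      rw [trNorm, termNorm_of_length_le le_rfl, normDefault_of_rootDefined hd]
      exact .zero_bot
    · refine ⟨Fin.last _, .nat 0, ?_, .inr rfl, h.le, fun _ => ⟨hlast h, rfl⟩⟩
      rw [trNorm, Fin.val_last, hlast h]
      exact .succ _
  have hstep := step_of_dec H.rules i (trNorm R PT A arΓ s) (trArgs R PT A arΓ s) hdec
  rw [Function.update_eq_self] at hstep
  rw [hl.tr_eq]
  refine .head' hstep (H.steps_mT_tr hρ σ i _ (fun u hu hu' => ?_) (.refl _)
    (H.rhs_depth_le ρ hρ))
  have hw : (u.subst σ).IsGround :=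
    hl.of_vars_subset (hu.vars_subset.trans (H.isTRS ρ hρ).2)
  have hbot : b = .bot ∨ Relation.TransGen Dec (trVal R PT A arΓ b) botT :=
    hb.imp_right fun h => by rw [h]; exact .single .zero_bot
  by_cases hwd : RootDefined R (u.subst σ)
  · have hud : RootDefined R u := by
      cases u with
      | var x =>
        exact absurd ⟨Term.subterm_var ((H.isTRS ρ hρ).2 (hu.vars_subset (Set.mem_singleton x))),
          fun e => (H.isTRS ρ hρ).1 x e.symm⟩ hu'
      | app f ts =>
        obtain ⟨f', us, e, h⟩ := hwd
        cases e
        exact ⟨_, ts, rfl, h⟩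
    have hpair := isPairStep_of_mem H.isTRS hρ hu hu' hud σ
    rw [← hs] at hpair
    obtain ⟨j, hj, heq, hgt⟩ := hpair.lexGt H.isTRS hwd H.good
      (H.pairs_eq ▸ hpair.mem_DP)
    have hji : j ≤ i := by omega
    have hjd : j < PT.depth + 1 := hji.trans_lt i.2
    refine H.steps_fillT_tr_of_le hw (j := ⟨j, hjd⟩) hji (fun k hk => ?_) ?_
    · rw [Function.update_of_ne (fun e => by subst e; exact absurd hji (not_le.2 hk)), trNorm,
        heq k hk, trNorm]
    · by_cases hij : (⟨j, hjd⟩ : Fin (PT.depth + 1)) = i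
      -- This happens only for a path of maximal length. Entry `i` was `1` and is now `0`, while the
      -- required value is smaller than `1`, so it is `0` or `⊥`.
      · subst hij
        obtain ⟨h1, rfl⟩ := hib hj
        have h1 : termNorm R PT s j = .nat 1 := h1
        rw [Function.update_self, trNorm]
        rw [h1] at hgt
        generalize termNorm R PT (u.subst σ) j = c at hgt
        cases hgt with
        | nat_nat h =>
          obtain rfl := Nat.lt_one_iff.1 h
          exact .inr ⟨rfl, rfl⟩
        | nat_bot => exact .inl (.single .zero_bot)
      · rw [Function.update_of_ne hij]
        exact .inl (H.dec_of_gt hgt fun u h => hground u h)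
  -- All entries have to become `⊥`. Lowering entry `0` suffices, since `N` provides the others.
  · have hN := H.not_rootDefined_trNorm hwd
    refine H.steps_fillT_tr_of_le hw (j := 0) (Fin.zero_le i)
      (fun k hk => absurd hk (Fin.not_lt_zero k)) ?_
    rw [hN]
    by_cases hi0 : 0 = i
    · subst hi0
      rw [Function.update_self]
      rcases hbot with rfl | h
      · exact .inr ⟨rfl, rfl⟩
      · exact .inl h
    · rw [Function.update_of_ne hi0]
      have hgt : (termNorm R PT s ((0 : Fin (PT.depth + 1)) : ℕ)).Gt .bot := by
        obtain ⟨f, ts, hft⟩ := hl.exists_app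
        rcases lt_or_ge 0 (currentPath R s PT).length with h0 | h0
        · rw [hft] at h0 ⊢
          rcases termNorm_cases H.isTRS H.good h0 with ⟨n, -, e⟩ | ⟨j, e⟩
          · rw [Fin.val_zero, e]; exact .nat_bot _
          · rw [Fin.val_zero, e]; exact .term_bot _
        · rw [Fin.val_zero, termNorm_of_length_le h0, normDefault_of_rootDefined hd]
          exact .nat_bot _
      exact .inl (H.dec_of_gt hgt fun u h => hground u h)

/-- Induction on the size covers the rewritten argument and the projected terms in the norm, which
are arguments too. The arguments are rewritten before the norm is adapted, so that `N` works on the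
new ones. -/
theorem stepsPlus_tr {s t : Term ar} (hs : s.IsGround) (hst : Step R s t) :
    StepsPlus Rs (tr R PT A arΓ s) (tr R PT A arΓ t) := by
  induction hn : s.size using Nat.strong_induction_on generalizing s t with
  | _ n ih =>
  subst hn
  cases hst with
  | root ρ hρ σ => exact H.stepsPlus_root hρ σ hs
  | arg f ts i t' h =>
    have ht := (Step.arg f ts i t' h).isGround H.isTRS hs
    have harg := ih _ (Term.size_arg_lt f ts i) (hs.arg i) h rfl
    have hargs : ∀ j, Steps Rs (trArgs R PT A arΓ (.app f ts) j)
        (trArgs R PT A arΓ (.app f (Function.update ts i t')) j) := by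
      intro j
      simp only [trArgs]
      split
      · rename_i hj
        by_cases hji : ⟨j, hj⟩ = i
        · subst hji
          rw [Function.update_self]
          exact harg.to_reflTransGen
        · rw [Function.update_of_ne hji]
          exact .refl
      · exact .refl
    have hplus : ∀ us : Fin (PT.depth + 1) → Term (simAr (PT.depth + 1) A arΓ),
        StepsPlus Rs (fT us (trArgs R PT A arΓ (.app f ts)))
          (fT us (trArgs R PT A arΓ (.app f (Function.update ts i t')))) := by
      intro us
      refine stepsPlus_fT (fun _ => .refl) hargs ⟨i, i.2.trans_le (H.arity_le f)⟩ ?_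
      rw [trArgs, trArgs, dif_pos i.2, dif_pos i.2]
      simpa using harg
    have hval : ∀ {k : Fin (PT.depth + 1)}, NormVal.StepEq R (termNorm R PT (.app f ts) k)
        (termNorm R PT (.app f (Function.update ts i t')) k) →
        Steps Rs (trNorm R PT A arΓ (.app f ts) k)
          (trNorm R PT A arΓ (.app f (Function.update ts i t')) k) := by
      intro k hk
      rw [trNorm, trNorm]
      generalize hb : termNorm R PT (.app f (Function.update ts i t')) k = b at hk
      generalize ha : termNorm R PT (.app f ts) k = a at hk
      cases hk with
      | refl => exact .refl
      | step huv =>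
        exact (ih _ (termNorm_size_lt ha) (H.isGround_of_termNorm_eq hs ha) huv
          rfl).to_reflTransGen
    rw [tr_app f ts]
    refine (hplus _).trans_left ?_
    rcases stepEq_or_lexGt H.isTRS h H.good with hall | ⟨j, hj, heq, hgt⟩
    · rw [tr_app]
      exact steps_fT (fun k => hval (hall k)) fun _ => .refl
    · have hjd : j < PT.depth + 1 :=
        hj.trans_le (length_currentPath_le H.isTRS (.app f ts) H.good).1
      exact (H.stepsPlus_fT_tr ht ⟨j, hjd⟩ (fun k hk => hval (heq k hk))
        (H.dec_of_gt hgt fun u h => H.isGround_of_termNorm_eq hs h)).to_reflTransGen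

/-- The exponent is only bounded from below by the depth, because all arguments arise from the same
copy of hᵏ(z) although some may be shallower. -/
theorem stepsPlus_h_iterate {t : Term ar} (ht : t.IsGround) {k : ℕ} (hk : t.depth ≤ k) :
    StepsPlus Rs (hT^[k] zT) (tr R PT A arΓ t) := by
  induction k generalizing t with
  | zero =>
    refine .head' (step_z H.rules (trNorm R PT A arΓ t)) (Relation.ReflTransGen.trans
      (steps_fillT (fun _ _ => .refl) fun j => ?_) (H.steps_fillT_tr ht (Nat.zero_le _)))
    obtain ⟨f, ts, rfl⟩ := ht.exists_app
    rw [trArgs, dif_neg]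
    · exact .refl
    · intro h
      have := (Finset.le_sup (f := fun k => (ts k).depth + 1) (Finset.mem_univ ⟨j, h⟩)).trans hk
      omega
  | succ k ih =>
    rw [Function.iterate_succ_apply']
    refine .head' (step_h H.rules (trNorm R PT A arΓ t) _) (Relation.ReflTransGen.trans
      (steps_fillT (fun _ _ => .refl) fun j => ?_) (H.steps_fillT_tr ht (Nat.zero_le _)))
    obtain ⟨f, ts, rfl⟩ := ht.exists_app
    rw [trArgs]
    split
    · rename_i h
      have := (Finset.le_sup (f := fun k => (ts k).depth + 1) (Finset.mem_univ ⟨j, h⟩)).trans hk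
      exact (ih (ht.arg _) (Nat.le_of_succ_le_succ this)).to_reflTransGen
    -- Padding positions hold a copy of hᵏ(z), which becomes an `f`-term and then `c`.
    · cases k with
      | zero =>
        exact Relation.ReflTransGen.head (step_z H.rules (trNorm R PT A arΓ (.app f ts)))
          (.single (step_fT_c H.rules _ _))
      | succ k =>
        rw [Function.iterate_succ_apply']
        exact .head (step_h H.rules (trNorm R PT A arΓ (.app f ts)) _)
          (.single (step_fT_c H.rules _ _))

end

end IsSimulation

end Simulation

/-! ### Comparison of derivational complexities -/

section Complexity

variable {F : Type*} {ar : F → ℕ}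

theorem RelIter.trans {r : Term ar → Term ar → Prop} {m n : ℕ} {s t u : Term ar}
    (h₁ : RelIter r m s t) (h₂ : RelIter r n t u) : RelIter r (m + n) s u := by
  induction m generalizing s with
  | zero =>
    obtain rfl : s = t := h₁
    rwa [Nat.zero_add]
  | succ m ih =>
    obtain ⟨v, hv, h⟩ := h₁
    rw [Nat.succ_add]
    exact ⟨v, hv, ih h⟩

theorem exists_relIter_of_transGen {r : Term ar → Term ar → Prop} {s t : Term ar}
    (h : Relation.TransGen r s t) : ∃ n, 1 ≤ n ∧ RelIter r n s t := by
  induction h with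
  | single h => exact ⟨1, le_rfl, _, h, rfl⟩
  | tail _ h ih =>
    obtain ⟨n, -, hn⟩ := ih
    exact ⟨n + 1, Nat.le_add_left _ _, hn.trans (n := 1) ⟨_, h, rfl⟩⟩

theorem RelIter.subst {R : Set (Rule ar)} {n : ℕ} {s t : Term ar} (σ : ℕ → Term ar)
    (h : RelIter (Step R) n s t) : RelIter (Step R) n (s.subst σ) (t.subst σ) := by
  induction n generalizing s with
  | zero => exact congrArg (Term.subst σ) h
  | succ n ih =>
    obtain ⟨u, hu, h⟩ := h
    exact ⟨_, hu.subst σ, ih h⟩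

theorem Term.size_subst_of_size_eq_one {σ : ℕ → Term ar} (hσ : ∀ x, (σ x).size = 1)
    (t : Term ar) : (t.subst σ).size = t.size := by
  induction t with
  | var x => exact hσ x
  | app f ts ih => simp only [subst, size, ih]

theorem Term.depth_lt_size (t : Term ar) : t.depth < t.size := by
  induction t with
  | var x => exact Nat.one_pos
  | app f ts ih =>
    rw [depth, Finset.sup_lt_iff (Nat.bot_eq_zero ▸ by simp [size])]
    intro i _
    have := ih i
    have := size_arg_lt f ts i
    omega

theorem Sim.size_hT_iterate {Γ : Type*} {d A : ℕ} {arΓ : Γ → ℕ} (k : ℕ) :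
    (hT^[k] (zT : Term (simAr d A arΓ))).size = k + 1 := by
  induction k with
  | zero => rfl
  | succ k ih =>
    rw [Function.iterate_succ_apply']
    have : ∀ t : Term (simAr d A arΓ), (hT t).size = 1 + t.size := fun t => by
      change 1 + ∑ _ : Fin 1, t.size = _
      simp
    rw [this, ih]
    omega

end Complexity

/-- Replacing all variables by a constant makes a term ground and preserves its size and the lengths
of its derivations. The start term built from `h` and `z` has size depth + 1, which is at most the
size of the term. -/
theorem IsSimulation.dc_le {F : Type*} {ar : F → ℕ} {R : Set (Rule ar)} {PT : ProofTree ar}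
    {g : ℕ → ℕ} {A C : ℕ} {Γ : Type*} {arΓ : Γ → ℕ} {gs : Γ}
    {Rs : Set (Rule (simAr (PT.depth + 1) A arΓ))} (H : IsSimulation R PT g A C gs Rs)
    (hconst : ∃ a, ar a = 0) (n : ℕ) : dc R n ≤ dc Rs n := by
  obtain ⟨a, ha⟩ := hconst
  have hempty : IsEmpty (Fin (ar a)) := ha ▸ Fin.isEmpty
  refine iSup₂_le fun t ht => dheight_le fun k t' hk => ?_
  set σ : ℕ → Term ar := fun _ => .app a fun i => isEmptyElim i
  have hground : (t.subst σ).IsGround := by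
    simp [Term.IsGround, Term.vars_subst, σ, Term.vars]
  have hsize : (t.subst σ).size = t.size :=
    Term.size_subst_of_size_eq_one (fun x => by simp [σ, Term.size]) t
  have key : ∀ (k : ℕ) {s u : Term ar}, s.IsGround → RelIter (Step R) k s u →
      ∃ m, k ≤ m ∧ RelIter (Step Rs) m (tr R PT A arΓ s) (tr R PT A arΓ u) := by
    intro k
    induction k with
    | zero => exact fun _ h => ⟨0, le_rfl, congrArg _ h⟩
    | succ k ih =>
      rintro s u hs ⟨v, hv, h⟩
      obtain ⟨m₁, hm₁, h₁⟩ := exists_relIter_of_transGen (H.stepsPlus_tr hs hv)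
      obtain ⟨m₂, hm₂, h₂⟩ := ih (hv.isGround H.isTRS hs) h
      exact ⟨m₁ + m₂, by omega, h₁.trans h₂⟩
  obtain ⟨m, hm, h⟩ := key k hground (hk.subst σ)
  obtain ⟨m', -, h'⟩ := exists_relIter_of_transGen (H.stepsPlus_h_iterate hground le_rfl)
  have hle : (Sim.hT^[(t.subst σ).depth] (Sim.zT : Term (simAr (PT.depth + 1) A arΓ))).size ≤ n := by
    rw [Sim.size_hT_iterate]
    have := Term.depth_lt_size (t.subst σ)
    omega
  calc (k : ℕ∞) ≤ ((m' + m : ℕ) : ℕ∞) := by exact_mod_cast hm.trans (Nat.le_add_left _ _)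
    _ ≤ dheight (Step Rs) (Sim.hT^[(t.subst σ).depth] Sim.zT) := le_dheight (h'.trans h)
    _ ≤ dc Rs n := le_iSup₂ (f := fun (t : Term (simAr (PT.depth + 1) A arΓ))
        (_ : t.size ≤ n) => dheight (Step Rs) t) _ hle

theorem lemma4p12 {F : Type*} (ar : F → ℕ) (hconst : ∃ a, ar a = 0)
    (R : Finset (Rule ar)) (hR : IsTRS (R : Set (Rule ar)))
    (PT : ProofTree ar) (hPT : PT.IsProofTreeOf (R : Set (Rule ar)))
    (g : ℕ → ℕ) (hg : IsReductionPairFunction (R : Set (Rule ar)) PT g)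
    (A : ℕ) (hA : ∀ f, ar f ≤ A) (hA1 : A ≠ 1)
    {Γ : Type*} (arΓ : Γ → ℕ) (gs : Γ) (Rg : Finset (Rule (simAr (PT.depth + 1) A arΓ)))
    (hRg : Sim.Computes gs Rg g) :
    (∀ s t : Term ar, s.IsGround → t.IsGround → Step (R : Set (Rule ar)) s t →
      StepsPlus (Rsim R PT A gs Rg)
        (tr (R : Set (Rule ar)) PT A arΓ s) (tr (R : Set (Rule ar)) PT A arΓ t)) ∧
    (∀ t : Term ar, t.IsGround →
      StepsPlus (Rsim R PT A gs Rg)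
        (Sim.hT^[t.depth] Sim.zT) (tr (R : Set (Rule ar)) PT A arΓ t)) ∧
    (∀ n : ℕ, dc (R : Set (Rule ar)) n ≤ dc (Rsim R PT A gs Rg) n) := by
  have H : IsSimulation (R : Set (Rule ar)) PT g A (rhsDepth R) gs (Rsim R PT A gs Rg) :=
    { isTRS := hR
      pairs_eq := hPT.1
      good := hPT.2.good hPT.1.subset hg.2.1 hg.2.2
      mono := hg.1
      arity_le := hA
      ne_one := hA1
      rhs_depth_le := fun ρ hρ => Finset.le_sup (f := fun ρ : Rule ar => ρ.rhs.depth) hρ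
      rules := fun ρ hρ => Or.inl hρ
      eval := fun n => (hRg.eval n).mono Set.subset_union_right }
  exact ⟨fun s t hs _ hst => H.stepsPlus_tr hs hst, fun t ht => H.stepsPlus_h_iterate ht le_rfl,
    H.dc_le hconst⟩
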